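/- Let $m>0$ and let $\eta,\tau\in\mathbb{R}$ satisfy $\eta^2-\tau^2=4$. Let $\sigma_0$ be the $2\times 2$ identity matrix and $$\sigma_1=\begin{pmatrix}0&1\\1&0\end{pmatrix},\qquad \sigma_2=\begin{pmatrix}0&-i\\i&0\end{pmatrix},\qquad \sigma_3=\begin{pmatrix}1&0\\0&-1\end{pmatrix},$$ $$\Lambda_{\eta,\tau}:=\left[i\sigma_1-\tfrac12(\eta\sigma_0+\tau\sigma_3)\right]^{-1}\left[i\sigma_1+\tfrac12(\eta\sigma_0+\tau\sigma_3)\right].$$ Let $\theta$ denote the Heaviside step function and, for $\Xi\in L^2(\mathbb{R},dk)$, put $$\psi_\Xi(x,y):=\frac{1}{2\sqrt\pi}\big[\theta(x)\,\Lambda_{\eta,\tau}+\theta(-x)\,\sigma_0\big]\int_{\mathbb{R}}dk\begin{pmatrix}\sqrt{\left(1-\frac{\tau}{\eta}\right)\left(\sqrt{k^2+\frac{4m^2}{\eta^2}}+k\right)}\\[2pt]-i\sqrt{\left(1+\frac{\tau}{\eta}\right)\left(\sqrt{k^2+\frac{4m^2}{\eta^2}}-k\right)}\end{pmatrix}\Xi(k)\,e^{iky-\sqrt{k^2+\frac{4m^2}{\eta^2}}\,|x|}.$$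 For $\mathcal O$ one of the observables $\sigma_3$ (spin), multiplication by $x$ or by $y$ (position), and $v_x=\sigma_1$, $v_y=\sigma_2$ (velocity), write $$\langle\mathcal O\rangle_\Xi:=\langle\psi_\Xi,\mathcal O\psi_\Xi\rangle,\qquad \langle(\Delta\mathcal O)^2\rangle_\Xi:=\|\mathcal O\psi_\Xi\|^2-\langle\mathcal O\rangle_\Xi^2,$$ with the inner product (antilinear in the first argument) and norm of $L^2(\mathbb{R}^2,dxdy;\mathbb{C}^2)$, and let $\mathscr D(x)$ and $\mathscr D(y)$ be the sets of those $\psi\in L^2(\mathbb{R}^2;\mathbb{C}^2)$ with $x\psi\in L^2(\mathbb{R}^2;\mathbb{C}^2)$ and $y\psi\in L^2(\mathbb{R}^2;\mathbb{C}^2)$, respectively. Then, for every $\Xi\in L^2(\mathbb{R},dk)$, $\psi_\Xi\in\mathscr D(x)$, and $\psi_\Xi\in\mathscr D(y)$ if and only if the distributional derivative $\partial_k\Xi$ belongs to $L^2(\mathbb{R},dk)$. Moreover, if $\|\Xi\|_{L^2(\mathbb{R})}=1$, then $$\langle\sigma_3\rangle_\Xi=-\frac{\tau}{\eta},\qquad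 \langle(\Delta\sigma_3)^2\rangle_\Xi=\frac{4}{\eta^2};$$ $$\langle x\rangle_\Xi=\frac{\tau}{2\eta}\Big\langle\Xi,\tfrac{k}{k^2+4m^2/\eta^2}\,\Xi\Big\rangle,\qquad \langle(\Delta x)^2\rangle_\Xi=\frac12\Big\|\tfrac{1}{\sqrt{k^2+4m^2/\eta^2}}\,\Xi\Big\|^2-\frac{\tau^2}{4\eta^2}\Big(\Big\langle\Xi,\tfrac{k}{k^2+4m^2/\eta^2}\,\Xi\Big\rangle\Big)^2;$$ $$\langle v_x\rangle_\Xi=\langle v_y\rangle_\Xi=0,\qquad \langle(\Delta v_x)^2\rangle_\Xi=\langle(\Delta v_y)^2\rangle_\Xi=1;$$ and, if in addition $\partial_k\Xi\in L^2(\mathbb{R},dk)$, $$\langle y\rangle_\Xi=\langle\Xi,i\partial_k\Xi\rangle,\qquad \langle(\Delta y)^2\rangle_\Xi=\|i\partial_k\Xi\|^2+\frac14\Big\|\tfrac{1}{\sqrt{k^2+4m^2/\eta^2}}\,\Xi\Big\|^2-\big(\langle\Xi,i\partial_k\Xi\rangle\big)^2.$$ -/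

import Mathlib

open MeasureTheory Complex
open scoped Matrix ContDiff ENNReal

noncomputable section

namespace DiracLine

/-- The space `ℂ²` of spinors, with its Hermitian norm. -/
abbrev Spinor := EuclideanSpace ℂ (Fin 2)

/-- Linear action of a `2 × 2` complex matrix on spinors. -/
def act (M : Matrix (Fin 2) (Fin 2) ℂ) (v : Spinor) : Spinor :=
  WithLp.toLp 2 (M *ᵥ v.ofLp)

/-! ### Pauli matrices -/

def σ₀ : Matrix (Fin 2) (Fin 2) ℂ := 1
def σ₁ : Matrix (Fin 2) (Fin 2) ℂ := !![0, 1; 1, 0]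
def σ₂ : Matrix (Fin 2) (Fin 2) ℂ := !![0, -I; I, 0]
def σ₃ : Matrix (Fin 2) (Fin 2) ℂ := !![1, 0; 0, -1]

/-! ### The eigenfunctions -/

/-- The transmission matrix
`Λ = [iσ₁ - (ησ₀ + τσ₃)/2]⁻¹ [iσ₁ + (ησ₀ + τσ₃)/2]`. -/
def transmission (η τ : ℝ) : Matrix (Fin 2) (Fin 2) ℂ :=
  (I • σ₁ - (1 / 2 : ℂ) • ((η : ℂ) • σ₀ + (τ : ℂ) • σ₃))⁻¹ *
    (I • σ₁ + (1 / 2 : ℂ) • ((η : ℂ) • σ₀ + (τ : ℂ) • σ₃))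

/-- `√(k² + 4m²/η²)`. -/
def freq (m η k : ℝ) : ℝ := √(k ^ 2 + 4 * m ^ 2 / η ^ 2)

/-- The momentum-space spinor
`(√((1 - τ/η)(√(k² + 4m²/η²) + k)), -i √((1 + τ/η)(√(k² + 4m²/η²) - k)))`. -/
def momentumSpinor (m η τ k : ℝ) : Spinor :=
  !₂[((√((1 - τ / η) * (freq m η k + k)) : ℝ) : ℂ),
     -I * ((√((1 + τ / η) * (freq m η k - k)) : ℝ) : ℂ)]

/-- The Heaviside step function (its value at `0` is immaterial here). -/
def heaviside (x : ℝ) : ℂ := if 0 < x then 1 else 0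

/-- The function `ψ_Ξ` on the plane. For `Ξ ∈ L²(ℝ)`, `m > 0` and `|τ| < |η|` the integral over `k`
converges absolutely whenever `x ≠ 0`. -/
def eigenfunction (m η τ : ℝ) (Ξ : ℝ → ℂ) (p : ℝ × ℝ) : Spinor :=
  ((1 / (2 * √Real.pi) : ℝ) : ℂ) •
    act (heaviside p.1 • transmission η τ + heaviside (-p.1) • σ₀)
      (∫ k : ℝ, (Ξ k * cexp (I * k * p.2 - ((freq m η k * |p.1| : ℝ) : ℂ))) • momentumSpinor m η τ k)

/-! ### `L²` norms and inner products, weak derivative -/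

/-- The `L²` norm. -/
def l2Norm {α E : Type*} [MeasureSpace α] [NormedAddCommGroup E] (f : α → E) : ℝ :=
  (eLpNorm f 2 volume).toReal

/-- The `L²` inner product, conjugate-linear in the first argument. -/
def l2Inner {α E : Type*} [MeasureSpace α] [NormedAddCommGroup E] [InnerProductSpace ℂ E]
    (f g : α → E) : ℂ :=
  ∫ a, inner ℂ (f a) (g a)

/-- `g` is the derivative of `f` on `ℝ` in the sense of distributions. -/
def HasWeakDeriv (f g : ℝ → ℂ) : Prop :=
  LocallyIntegrable f ∧ LocallyIntegrable g ∧
    ∀ φ : ℝ → ℂ, ContDiff ℝ ∞ φ → HasCompactSupport φ →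
      ∫ k, f k * deriv φ k = -∫ k, g k * φ k

/-! ### Observables on `L²(ℝ², ℂ²)` -/

/-- An observable, given by its action on spinor-valued functions on the plane. -/
abbrev Observable := (ℝ × ℝ → Spinor) → (ℝ × ℝ → Spinor)

/-- The maximal domain `{ψ ∈ L² | Oψ ∈ L²}`. -/
def InDomain (O : Observable) (ψ : ℝ × ℝ → Spinor) : Prop :=
  MemLp ψ 2 volume ∧ MemLp (O ψ) 2 volume

/-- The expectation value `⟨ψ, O ψ⟩`. -/
def mean (O : Observable) (ψ : ℝ × ℝ → Spinor) : ℂ := l2Inner ψ (O ψ)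

/-- The variance `‖O ψ‖² - ⟨ψ, O ψ⟩²`. -/
def variance (O : Observable) (ψ : ℝ × ℝ → Spinor) : ℂ :=
  (l2Norm (O ψ) : ℂ) ^ 2 - mean O ψ ^ 2

/-- The spin observable `σ₃`. -/
def spin : Observable := fun ψ p => act σ₃ (ψ p)

/-- Position in the direction transversal to the line. -/
def posX : Observable := fun ψ p => (p.1 : ℂ) • ψ p

/-- Position in the direction of the line. -/
def posY : Observable := fun ψ p => (p.2 : ℂ) • ψ p

/-- The first component of the velocity, the bounded operator `v_x = i[D₀, x] = σ₁`
(see `velX_eq_commutator`). -/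
def velX : Observable := fun ψ p => act σ₁ (ψ p)

/-- The second component of the velocity, the bounded operator `v_y = i[D₀, y] = σ₂`
(see `velY_eq_commutator`). -/
def velY : Observable := fun ψ p => act σ₂ (ψ p)

/-- The free Dirac expression `D₀ = -i(σ₁ ∂ₓ + σ₂ ∂_y) + m σ₃`, on differentiable functions. -/
def freeDirac (m : ℝ) : Observable := fun φ p =>
  -I • (act σ₁ (fderiv ℝ φ p (1, 0)) + act σ₂ (fderiv ℝ φ p (0, 1))) + (m : ℂ) • act σ₃ (φ p)

lemma act_add (M : Matrix (Fin 2) (Fin 2) ℂ) (v w : Spinor) :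
    act M (v + w) = act M v + act M w := by
  simp only [act, WithLp.ofLp_add, Matrix.mulVec_add, WithLp.toLp_add]

lemma act_smul (M : Matrix (Fin 2) (Fin 2) ℂ) (c : ℂ) (v : Spinor) :
    act M (c • v) = c • act M v := by
  simp only [act, WithLp.ofLp_smul, Matrix.mulVec_smul, WithLp.toLp_smul]

lemma fderiv_coord_smul (L : ℝ × ℝ →L[ℝ] ℝ) (φ : ℝ × ℝ → Spinor) (p v : ℝ × ℝ)
    (hφ : DifferentiableAt ℝ φ p) :
    fderiv ℝ (fun q => ((L q : ℝ) : ℂ) • φ q) p v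
      = ((L p : ℝ) : ℂ) • fderiv ℝ φ p v + ((L v : ℝ) : ℂ) • φ p := by
  have h := (L.hasFDerivAt (x := p)).smul hφ.hasFDerivAt
  have e : (fun q => ((L q : ℝ) : ℂ) • φ q) = fun q => L q • φ q := by
    funext q; exact Complex.coe_smul _ _
  rw [e, show (fun q => L q • φ q) = (L : ℝ × ℝ → ℝ) • φ from rfl, h.fderiv]
  simp

theorem velX_eq_commutator (m : ℝ) (φ : ℝ × ℝ → Spinor) (hφ : Differentiable ℝ φ) :
    I • (freeDirac m (posX φ) - posX (freeDirac m φ)) = velX φ := by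
  funext p
  have h := fun v => fderiv_coord_smul (ContinuousLinearMap.fst ℝ ℝ ℝ) φ p v (hφ p)
  simp only [ContinuousLinearMap.coe_fst'] at h
  have e : posX φ = fun q => (q.1 : ℂ) • φ q := rfl
  change I • (freeDirac m (posX φ) p - (p.1 : ℂ) • freeDirac m φ p) = act σ₁ (φ p)
  simp only [freeDirac, e, h, act_add, act_smul, Complex.ofReal_one, Complex.ofReal_zero]
  match_scalars <;> ring_nf <;> simp

theorem velY_eq_commutator (m : ℝ) (φ : ℝ × ℝ → Spinor) (hφ : Differentiable ℝ φ) :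
    I • (freeDirac m (posY φ) - posY (freeDirac m φ)) = velY φ := by
  funext p
  have h := fun v => fderiv_coord_smul (ContinuousLinearMap.snd ℝ ℝ ℝ) φ p v (hφ p)
  simp only [ContinuousLinearMap.coe_snd'] at h
  have e : posY φ = fun q => (q.2 : ℂ) • φ q := rfl
  change I • (freeDirac m (posY φ) p - (p.2 : ℂ) • freeDirac m φ p) = act σ₂ (φ p)
  simp only [freeDirac, e, h, act_add, act_smul, Complex.ofReal_one, Complex.ofReal_zero]
  match_scalars <;> ring_nf <;> simp

end DiracLine

end

noncomputable section

namespace DiracLine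

open scoped FourierTransform SchwartzMap

section Plancherel

theorem ae_memLp_fibre {F : Type*} [NormedAddCommGroup F] {f : ℝ × ℝ → F} (hf : MemLp f 2 volume) :
    ∀ᵐ x : ℝ, MemLp (fun k => f (x, k)) 2 volume := by
  have h := (memLp_two_iff_integrable_sq_norm hf.1).1 hf
  filter_upwards [h.prod_right_ae, hf.1.prodMk_left] with x h1 h2
  exact (memLp_two_iff_integrable_sq_norm h2).2 h1

variable {F : Type*} [NormedAddCommGroup F] [InnerProductSpace ℂ F]

/-- The `L²` Fourier transform of an integrable function is given by the Fourier integral. -/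
theorem fourier_toLp_ae_eq [CompleteSpace F] {f : ℝ → F} (h1 : Integrable f) (h2 : MemLp f 2 volume) :
    ((𝓕 (h2.toLp f) : Lp F 2 (volume : Measure ℝ)) : ℝ → F) =ᵐ[volume] 𝓕 f := by
  have hcont : Continuous (𝓕 f) := by
    simpa using! VectorFourier.fourierIntegral_continuous Real.continuous_fourierChar
      (by exact (innerSL ℝ).continuous₂) h1
  have hloc : LocallyIntegrable
      ((𝓕 (h2.toLp f) : Lp F 2 (volume : Measure ℝ)) : ℝ → F) :=
    (Lp.memLp _).locallyIntegrable (by norm_num)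
  refine ae_eq_of_integral_contDiff_smul_eq hloc hcont.locallyIntegrable ?_
  intro g hg hgc
  let φ : 𝓢(ℝ, ℂ) := (hgc.comp_left (g := ((↑) : ℝ → ℂ)) (by simp)).toSchwartzMap
    (Complex.ofRealCLM.contDiff.comp hg)
  have hφ : ∀ x, φ x = (g x : ℂ) := fun x => rfl
  have key := congrArg (fun T => T φ) (Lp.fourier_toTemperedDistribution_eq (h2.toLp f))
  simp only [TemperedDistribution.fourier_apply, Lp.toTemperedDistribution_apply] at key
  have e1 : ∫ x, (𝓕 φ) x • (h2.toLp f) x = ∫ x, (𝓕 φ) x • f x :=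
    integral_congr_ae (by filter_upwards [h2.coeFn_toLp] with x hx using by rw [hx])
  have e2 : ∫ x, (𝓕 φ) x • f x = ∫ x, φ x • (𝓕 f) x := by
    simpa using! VectorFourier.integral_fourierIntegral_smul_eq_flip (L := innerₗ ℝ)
      Real.continuous_fourierChar continuous_inner φ.integrable h1
  have e3 := key.symm.trans (e1.trans e2)
  simpa only [hφ, Complex.coe_smul] using e3

/-- The integral `∫ e^{iky} f(k) dk`. -/
def fourierExp (f : ℝ → F) (y : ℝ) : F := ∫ k : ℝ, cexp (I * k * y) • f k

theorem fourierExp_eq (f : ℝ → F) (y : ℝ) :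
    fourierExp f y = 𝓕 f (-(2 * Real.pi)⁻¹ * y) := by
  rw [fourierExp, Real.fourier_real_eq_integral_exp_smul]
  congr 1; ext k; congr 2
  have : (Real.pi : ℂ) ≠ 0 := by exact_mod_cast Real.pi_ne_zero
  push_cast; field_simp

theorem integrable_inner_fourier [CompleteSpace F] {f g : ℝ → F} (hf : Integrable f) (hf2 : MemLp f 2 volume)
    (hg : Integrable g) (hg2 : MemLp g 2 volume) :
    Integrable (fun y => inner ℂ (𝓕 f y) (𝓕 g y)) ∧
      ∫ y, inner ℂ (𝓕 f y) (𝓕 g y) = ∫ k, inner ℂ (f k) (g k) := by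
  have e : (fun y => inner ℂ ((𝓕 (hf2.toLp f) : Lp F 2 (volume : Measure ℝ)) y)
      ((𝓕 (hg2.toLp g) : Lp F 2 (volume : Measure ℝ)) y)) =ᵐ[volume]
      fun y => inner ℂ (𝓕 f y) (𝓕 g y) := by
    filter_upwards [fourier_toLp_ae_eq hf hf2, fourier_toLp_ae_eq hg hg2] with y h1 h2
    rw [h1, h2]
  refine ⟨(L2.integrable_inner _ _).congr e, ?_⟩
  rw [← integral_congr_ae e]
  have h := Lp.inner_fourier_eq (hf2.toLp f) (hg2.toLp g)
  rw [L2.inner_def, L2.inner_def] at h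
  rw [h]
  refine integral_congr_ae ?_
  filter_upwards [hf2.coeFn_toLp, hg2.coeFn_toLp] with y h1 h2
  rw [h1, h2]

theorem integrable_inner_fourierExp [CompleteSpace F] {f g : ℝ → F} (hf : Integrable f) (hf2 : MemLp f 2 volume)
    (hg : Integrable g) (hg2 : MemLp g 2 volume) :
    Integrable (fun y => inner ℂ (fourierExp f y) (fourierExp g y)) := by
  simp only [fourierExp_eq]
  exact (integrable_inner_fourier hf hf2 hg hg2).1.comp_mul_left'
    (R := -(2 * Real.pi)⁻¹) (by simp [Real.pi_ne_zero])

/-- Plancherel's identity for `f ↦ ∫ e^{iky} f(k) dk` on `L¹ ∩ L²`. -/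
theorem integral_inner_fourierExp [CompleteSpace F] {f g : ℝ → F} (hf : Integrable f) (hf2 : MemLp f 2 volume)
    (hg : Integrable g) (hg2 : MemLp g 2 volume) :
    ∫ y, inner ℂ (fourierExp f y) (fourierExp g y)
      = (2 * Real.pi : ℝ) * ∫ k, inner ℂ (f k) (g k) := by
  simp only [fourierExp_eq]
  rw [Measure.integral_comp_mul_left (fun y => inner ℂ (𝓕 f y) (𝓕 g y)),
    (integrable_inner_fourier hf hf2 hg hg2).2, inv_neg, inv_inv, abs_neg,
    abs_of_pos (by positivity), Complex.real_smul]

/-- The Fourier integral in the second variable. -/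
def partialFourier (f : ℝ × ℝ → F) (p : ℝ × ℝ) : F := fourierExp (fun k => f (p.1, k)) p.2

theorem aestronglyMeasurable_partialFourier {f : ℝ × ℝ → F} (hf : AEStronglyMeasurable f) :
    AEStronglyMeasurable (partialFourier f) := by
  have h : AEStronglyMeasurable (fun q : (ℝ × ℝ) × ℝ => f (q.1.1, q.2))
      ((volume : Measure (ℝ × ℝ)).prod volume) := by
    refine hf.comp_quasiMeasurePreserving (f := fun q : (ℝ × ℝ) × ℝ => (q.1.1, q.2)) ?_
    exact QuasiMeasurePreserving.prodMap Measure.quasiMeasurePreserving_fst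
      (Measure.QuasiMeasurePreserving.id volume)
  have h2 : AEStronglyMeasurable
      (fun q : (ℝ × ℝ) × ℝ => cexp (I * q.2 * q.1.2) • f (q.1.1, q.2))
      ((volume : Measure (ℝ × ℝ)).prod volume) :=
    (Continuous.aestronglyMeasurable (by fun_prop)).smul h
  exact h2.integral_prod_right'

theorem integrable_inner_of_memLp {α : Type*} [MeasurableSpace α] {μ : Measure α} {f g : α → F}
    (hf : MemLp f 2 μ) (hg : MemLp g 2 μ) : Integrable (fun a => inner ℂ (f a) (g a)) μ := by
  refine (L2.integrable_inner (𝕜 := ℂ) (hf.toLp f) (hg.toLp g)).congr ?_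
  filter_upwards [hf.coeFn_toLp, hg.coeFn_toLp] with y h1 h2
  rw [h1, h2]

theorem integral_inner_self_re {α : Type*} [MeasurableSpace α] {μ : Measure α} (f : α → F) :
    ∫ a, inner ℂ (f a) (f a) ∂μ = ((∫ a, ‖f a‖ ^ 2 ∂μ : ℝ) : ℂ) := by
  rw [← integral_complex_ofReal]
  congr 1; ext a
  rw [inner_self_eq_norm_sq_to_K]; simp

theorem memLp_partialFourier [CompleteSpace F] {f : ℝ × ℝ → F} (hf : MemLp f 2 volume)
    (hf1 : ∀ᵐ x : ℝ, Integrable (fun k => f (x, k))) : MemLp (partialFourier f) 2 volume := by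
  have hm := aestronglyMeasurable_partialFourier hf.1
  rw [memLp_two_iff_integrable_sq_norm hm]
  have hm2 : AEStronglyMeasurable (fun p => ‖partialFourier f p‖ ^ 2) := hm.norm.pow 2
  rw [Measure.volume_eq_prod] at hm2 ⊢
  have hi := (memLp_two_iff_integrable_sq_norm hf.1).1 hf
  rw [Measure.volume_eq_prod] at hi
  have hval : ∀ᵐ x : ℝ, Integrable (fun y => ‖partialFourier f (x, y)‖ ^ 2) ∧
      ∫ y, ‖partialFourier f (x, y)‖ ^ 2 = 2 * Real.pi * ∫ k, ‖f (x, k)‖ ^ 2 := by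
    filter_upwards [ae_memLp_fibre hf, hf1] with x h2 h1
    have a := integrable_inner_fourierExp h1 h2 h1 h2
    have b := integral_inner_fourierExp h1 h2 h1 h2
    rw [integral_inner_self_re, integral_inner_self_re] at b
    constructor
    · refine (a.re).congr (Filter.Eventually.of_forall fun y => ?_)
      simp only [inner_self_eq_norm_sq_to_K]
      simp [partialFourier, ← Complex.ofReal_pow]
    · exact_mod_cast b
  rw [integrable_prod_iff hm2]
  refine ⟨hval.mono fun x h => h.1, ?_⟩
  have hc : Integrable (fun x => 2 * Real.pi * ∫ k, ‖f (x, k)‖ ^ 2) :=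
    hi.integral_prod_left.const_mul _
  refine hc.congr ?_
  filter_upwards [hval] with x h
  simp only [norm_pow, norm_norm]
  exact h.2.symm

theorem integral_inner_partialFourier [CompleteSpace F] {f g : ℝ × ℝ → F} (hf : MemLp f 2 volume)
    (hf1 : ∀ᵐ x : ℝ, Integrable (fun k => f (x, k))) (hg : MemLp g 2 volume)
    (hg1 : ∀ᵐ x : ℝ, Integrable (fun k => g (x, k))) :
    ∫ p, inner ℂ (partialFourier f p) (partialFourier g p)
      = (2 * Real.pi : ℝ) * ∫ p, inner ℂ (f p) (g p) := by
  have a := integrable_inner_of_memLp (memLp_partialFourier hf hf1) (memLp_partialFourier hg hg1)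
  have b := integrable_inner_of_memLp hf hg
  rw [Measure.volume_eq_prod] at a b ⊢
  rw [integral_prod _ a, integral_prod _ b, ← integral_const_mul]
  refine integral_congr_ae ?_
  filter_upwards [ae_memLp_fibre hf, hf1, ae_memLp_fibre hg, hg1] with x h1 h2 h3 h4
  exact integral_inner_fourierExp h2 h1 h4 h3

end Plancherel

section WeakDerivative

open Filter Topology

theorem hasWeakDeriv_of_contDiff {φ : ℝ → ℂ} (hφ : ContDiff ℝ ∞ φ) :
    HasWeakDeriv φ (deriv φ) := by
  have hd : Continuous (deriv φ) := hφ.continuous_deriv (by simp)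
  refine ⟨hφ.continuous.locallyIntegrable, hd.locallyIntegrable, fun ψ hψ hc => ?_⟩
  have hψd : Continuous (deriv ψ) := hψ.continuous_deriv (by simp)
  refine integral_mul_deriv_eq_deriv_mul_of_integrable
    (fun x _ => (hφ.differentiable (by simp) x).hasDerivAt)
    (fun x _ => (hψ.differentiable (by simp) x).hasDerivAt) ?_ ?_ ?_
  · exact (hφ.continuous.mul hψd).integrable_of_hasCompactSupport hc.deriv.mul_left
  · exact (hd.mul hψ.continuous).integrable_of_hasCompactSupport hc.mul_left
  · exact (hφ.continuous.mul hψ.continuous).integrable_of_hasCompactSupport hc.mul_left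

theorem HasWeakDeriv.integral_cutoff_eq_zero {f f' g g' : ℝ → ℂ} (hf : HasWeakDeriv f f')
    (hg : ContDiff ℝ ∞ g) (hg' : ∀ k, HasDerivAt g (g' k) k) {χ : ℝ → ℝ} (hχ : ContDiff ℝ ∞ χ)
    (hχc : HasCompactSupport χ) {ε : ℝ} (hε : ε ≠ 0) :
    ∫ k, ((ε * deriv χ (ε * k) : ℝ) * (f k * g k)
      + (χ (ε * k) : ℝ) * (f' k * g k + f k * g' k)) = 0 := by
  set φ : ℝ → ℂ := fun k => (χ (ε * k) : ℂ) * g k with hφdef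
  have hφ : ContDiff ℝ ∞ φ :=
    (Complex.ofRealCLM.contDiff.comp (hχ.comp (contDiff_const.mul contDiff_id))).mul hg
  have hc : HasCompactSupport φ := by
    refine HasCompactSupport.mul_right ?_
    have := hχc.comp_smul hε
    exact this.comp_left (g := ((↑) : ℝ → ℂ)) (by simp)
  have hder : ∀ k, deriv φ k = ((ε * deriv χ (ε * k) : ℝ) : ℂ) * g k + χ (ε * k) * g' k := by
    intro k
    have h1 : HasDerivAt (fun k : ℝ => ((χ (ε * k) : ℝ) : ℂ)) ((ε * deriv χ (ε * k) : ℝ) : ℂ) k := by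
      have h0 : HasDerivAt (fun k : ℝ => ε * k) ε k := by
        simpa using (hasDerivAt_id k).const_mul ε
      have := ((hχ.differentiable (by simp) (ε * k)).hasDerivAt.comp k h0).ofReal_comp
      simpa [mul_comm] using this
    exact (h1.mul (hg' k)).deriv
  have h := hf.2.2 φ hφ hc
  have i1 : Integrable (fun k => f k * deriv φ k) := by
    simpa [mul_comm] using! hf.1.integrable_smul_left_of_hasCompactSupport
      (hφ.continuous_deriv (by simp)) hc.deriv
  have i2 : Integrable (fun k => f' k * φ k) := by
    simpa [mul_comm] using! hf.2.1.integrable_smul_left_of_hasCompactSupport hφ.continuous hc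
  rw [eq_neg_iff_add_eq_zero, ← integral_add i1 i2] at h
  rw [← h]
  congr 1; ext k
  rw [hder]
  simp only [hφdef]
  ring

/-- Integration by parts on the whole line, without boundary terms. -/
theorem HasWeakDeriv.integral_eq_zero {f f' g g' : ℝ → ℂ} (hf : HasWeakDeriv f f')
    (hg : ContDiff ℝ ∞ g) (hg' : ∀ k, HasDerivAt g (g' k) k)
    (h1 : Integrable (fun k => f k * g k)) (h2 : Integrable (fun k => f' k * g k + f k * g' k)) :
    ∫ k, (f' k * g k + f k * g' k) = 0 := by
  let χ : ContDiffBump (0 : ℝ) := ⟨1, 2, by norm_num, by norm_num⟩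
  have hχ : ContDiff ℝ ∞ χ := χ.contDiff
  obtain ⟨C, hC⟩ := χ.hasCompactSupport.deriv.exists_bound_of_continuous
    (hχ.continuous_deriv (by simp))
  have hlim : Tendsto (fun N : ℕ => ∫ k, (((1 / ((N : ℝ) + 1)) * deriv χ ((1 / ((N : ℝ) + 1)) * k) : ℝ)
      * (f k * g k) + (χ ((1 / ((N : ℝ) + 1)) * k) : ℝ) * (f' k * g k + f k * g' k))) atTop
      (𝓝 (∫ k, (f' k * g k + f k * g' k))) := by
    refine tendsto_integral_of_dominated_convergence
      (fun k => C * ‖f k * g k‖ + ‖f' k * g k + f k * g' k‖) ?_ ?_ ?_ ?_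
    · intro N
      refine (AEStronglyMeasurable.mul ?_ h1.1).add (AEStronglyMeasurable.mul ?_ h2.1)
      · have := hχ.continuous_deriv (by simp)
        exact Continuous.aestronglyMeasurable (by fun_prop)
      · have := hχ.continuous
        exact Continuous.aestronglyMeasurable (by fun_prop)
    · exact (h1.norm.const_mul C).add h2.norm
    · intro N
      refine Eventually.of_forall fun k => (norm_add_le _ _).trans (add_le_add ?_ ?_)
      · rw [norm_mul]
        refine mul_le_mul_of_nonneg_right ?_ (norm_nonneg _)
        rw [Complex.norm_real, norm_mul]
        have hN : ‖(1 / ((N : ℝ) + 1))‖ ≤ 1 := by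
          rw [Real.norm_of_nonneg (by positivity), div_le_one (by positivity)]; simp
        calc _ ≤ 1 * C := mul_le_mul hN (hC _) (norm_nonneg _) zero_le_one
          _ = C := one_mul C
      · rw [norm_mul, Complex.norm_real, Real.norm_of_nonneg χ.nonneg]
        exact mul_le_of_le_one_left (norm_nonneg _) χ.le_one
    · refine Eventually.of_forall fun k => ?_
      have t0 : Tendsto (fun N : ℕ => 1 / ((N : ℝ) + 1)) atTop (𝓝 0) :=
        tendsto_one_div_add_atTop_nhds_zero_nat
      have t1 : Tendsto (fun N : ℕ => (1 / ((N : ℝ) + 1)) * k) atTop (𝓝 0) := by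
        simpa using t0.mul_const k
      have t2 : Tendsto (fun N : ℕ => χ ((1 / ((N : ℝ) + 1)) * k)) atTop (𝓝 1) := by
        have := (hχ.continuous.tendsto 0).comp t1
        rwa [χ.one_of_mem_closedBall (by simp [χ])] at this
      have t3 : Tendsto (fun N : ℕ => (1 / ((N : ℝ) + 1)) * deriv χ ((1 / ((N : ℝ) + 1)) * k))
          atTop (𝓝 (0 * deriv χ 0)) :=
        t0.mul (((hχ.continuous_deriv (by simp)).tendsto 0).comp t1)
      have t2' := (Complex.continuous_ofReal.tendsto _).comp t2
      have t3' := (Complex.continuous_ofReal.tendsto _).comp t3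
      have := (t3'.mul_const (f k * g k)).add (t2'.mul_const (f' k * g k + f k * g' k))
      simpa using this
  refine tendsto_nhds_unique hlim ?_
  have : ∀ N : ℕ, ∫ k, (((1 / ((N : ℝ) + 1)) * deriv χ ((1 / ((N : ℝ) + 1)) * k) : ℝ)
      * (f k * g k) + (χ ((1 / ((N : ℝ) + 1)) * k) : ℝ) * (f' k * g k + f k * g' k)) = 0 := fun N =>
    hf.integral_cutoff_eq_zero hg hg' hχ χ.hasCompactSupport (by positivity)
  simp only [this]
  exact tendsto_const_nhds

theorem integrable_exp_smul {F : Type*} [NormedAddCommGroup F] [NormedSpace ℂ F] {f : ℝ → F}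
    (hf : Integrable f) (y : ℝ) : Integrable (fun k : ℝ => cexp (I * k * y) • f k) := by
  refine hf.bdd_smul 1 (Continuous.aestronglyMeasurable (by fun_prop))
    (Eventually.of_forall fun k => ?_)
  rw [show I * (k : ℂ) * y = ((k * y : ℝ) : ℂ) * I by push_cast; ring,
    Complex.norm_exp_ofReal_mul_I]

/-- Under `f ↦ ∫ e^{iky} f(k) dk`, multiplication by `y` corresponds to `i∂ₖ`. -/
theorem HasWeakDeriv.fourierExp_eq {f f' g g' : ℝ → ℂ} (hf : HasWeakDeriv f f')
    (hg : ContDiff ℝ ∞ g) (hg' : ∀ k, HasDerivAt g (g' k) k)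
    (h1 : Integrable (fun k => f k * g k)) (h2 : Integrable (fun k => f' k * g k + f k * g' k))
    (y : ℝ) :
    fourierExp (fun k => I * (f' k * g k + f k * g' k)) y
      = y * fourierExp (fun k => f k * g k) y := by
  have he : ∀ k : ℝ, HasDerivAt (fun k : ℝ => cexp (I * k * y)) (I * y * cexp (I * k * y)) k := by
    intro k
    have h0 : HasDerivAt (fun k : ℝ => I * (k : ℂ) * y) (I * y) k := by
      simpa using (((hasDerivAt_id k).ofReal_comp).const_mul I).mul_const (y : ℂ)
    simpa [mul_comm] using h0.cexp
  have hec : ContDiff ℝ ∞ (fun k : ℝ => cexp (I * k * y)) :=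
    ((contDiff_const.mul Complex.ofRealCLM.contDiff).mul contDiff_const).cexp
  have i1 : Integrable (fun k : ℝ => cexp (I * k * y) * (f k * g k)) :=
    integrable_exp_smul h1 y
  have i2 : Integrable (fun k : ℝ => cexp (I * k * y) * (f' k * g k + f k * g' k)) :=
    integrable_exp_smul h2 y
  have hz := hf.integral_eq_zero (hec.mul hg) (fun k => (he k).mul (hg' k))
    (i1.congr (Eventually.of_forall fun k => by ring))
    ((i2.add (i1.const_mul (I * y))).congr (Eventually.of_forall fun k => by
      simp only [Pi.add_apply]; ring))
  have e : ∫ k : ℝ, (cexp (I * k * y) * (f' k * g k + f k * g' k)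
      + I * y * (cexp (I * k * y) * (f k * g k))) = 0 := by
    rw [← hz]; congr 1; ext k; ring
  rw [integral_add i2 (i1.const_mul _), integral_const_mul] at e
  simp only [fourierExp, smul_eq_mul]
  have e2 : ∀ k : ℝ, cexp (I * k * y) * (I * (f' k * g k + f k * g' k))
      = I * (cexp (I * k * y) * (f' k * g k + f k * g' k)) := fun k => by ring
  simp only [e2]
  rw [integral_const_mul, eq_neg_of_add_eq_zero_left e]
  linear_combination (-(y : ℂ) * ∫ k : ℝ, cexp (I * k * y) * (f k * g k)) * Complex.I_sq

end WeakDerivative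

section Laplace

open Set

theorem integrableOn_quadratic_mul_exp {r : ℝ} (hr : 0 < r) (a b c : ℝ) :
    IntegrableOn (fun x : ℝ => Real.exp (-(r * x)) * (a + b * x + c * x ^ 2)) (Ioi 0) := by
  have h : ∀ n : ℕ, IntegrableOn (fun x : ℝ => Real.exp (-(r * x)) * x ^ n) (Ioi 0) := fun n => by
    have := integrableOn_rpow_mul_exp_neg_mul_rpow (p := 1) (s := n) (b := r)
      (by have := n.cast_nonneg (α := ℝ); linarith) zero_lt_one hr
    simpa [mul_comm] using this
  refine Integrable.congr
    (((h 0).const_mul a).add (((h 1).const_mul b).add ((h 2).const_mul c)))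
    (Filter.Eventually.of_forall fun x => ?_)
  simp only [Pi.add_apply]; ring

theorem integral_quadratic_mul_exp {r : ℝ} (hr : 0 < r) (a b c : ℝ) :
    ∫ x in Ioi (0 : ℝ), Real.exp (-(r * x)) * (a + b * x + c * x ^ 2)
      = a / r + b / r ^ 2 + 2 * c / r ^ 3 := by
  have hi : ∀ n : ℕ, IntegrableOn (fun x : ℝ => Real.exp (-(r * x)) * x ^ n) (Ioi 0) := fun n => by
    have := integrableOn_rpow_mul_exp_neg_mul_rpow (p := 1) (s := n) (b := r)
      (by have := n.cast_nonneg (α := ℝ); linarith) zero_lt_one hr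
    simpa [mul_comm] using this
  have h : ∀ n : ℕ, ∫ x in Ioi (0 : ℝ), Real.exp (-(r * x)) * x ^ n
      = n.factorial / r ^ (n + 1) := fun n => by
    have := Real.integral_rpow_mul_exp_neg_mul_Ioi (a := n + 1) (r := r) (by positivity) hr
    rw [Real.Gamma_nat_eq_factorial, show (n : ℝ) + 1 = ((n + 1 : ℕ) : ℝ) by push_cast; ring,
      Real.rpow_natCast] at this
    rw [show (n.factorial : ℝ) / r ^ (n + 1) = (1 / r) ^ (n + 1) * n.factorial by
      rw [one_div, inv_pow]; ring, ← this]
    refine setIntegral_congr_fun measurableSet_Ioi fun x _ => ?_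
    simp [mul_comm]
  have e : ∀ x : ℝ, Real.exp (-(r * x)) * (a + b * x + c * x ^ 2)
      = a * (Real.exp (-(r * x)) * x ^ 0) + (b * (Real.exp (-(r * x)) * x ^ 1)
        + c * (Real.exp (-(r * x)) * x ^ 2)) := fun x => by ring
  simp only [e]
  have hbc : IntegrableOn (fun x : ℝ => b * (Real.exp (-(r * x)) * x ^ 1)
      + c * (Real.exp (-(r * x)) * x ^ 2)) (Ioi 0) :=
    Integrable.add ((hi 1).const_mul b) ((hi 2).const_mul c)
  rw [integral_add ((hi 0).const_mul a) hbc, integral_add ((hi 1).const_mul b) ((hi 2).const_mul c), integral_const_mul, integral_const_mul,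
    integral_const_mul, h, h, h]
  simp; ring

/-- A two-sided Laplace integral. -/
theorem integral_two_sided {r : ℝ} (hr : 0 < r) (a b c a' b' c' : ℝ) :
    Integrable (fun x : ℝ => Real.exp (-(r * |x|)) *
      (if 0 < x then a + b * |x| + c * |x| ^ 2 else a' + b' * |x| + c' * |x| ^ 2)) ∧
    ∫ x : ℝ, Real.exp (-(r * |x|)) *
      (if 0 < x then a + b * |x| + c * |x| ^ 2 else a' + b' * |x| + c' * |x| ^ 2)
      = (a + a') / r + (b + b') / r ^ 2 + 2 * (c + c') / r ^ 3 := by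
  set f : ℝ → ℝ := fun x => Real.exp (-(r * |x|)) *
      (if 0 < x then a + b * |x| + c * |x| ^ 2 else a' + b' * |x| + c' * |x| ^ 2) with hf
  set g : ℝ → ℝ := fun x => Real.exp (-(r * x)) * (a' + b' * x + c' * x ^ 2) with hg
  have e1 : EqOn (fun x : ℝ => Real.exp (-(r * x)) * (a + b * x + c * x ^ 2)) f (Ioi 0) := by
    intro x hx
    have hx' : 0 < x := hx
    simp [hf, hx', abs_of_pos hx']
  have e2 : EqOn (fun x => g (-x)) f (Iic 0) := by
    intro x hx
    have hx' : x ≤ 0 := hx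
    simp [hf, hg, not_lt.2 hx', abs_of_nonpos hx']
  have i1 : IntegrableOn f (Ioi 0) :=
    (integrableOn_quadratic_mul_exp hr a b c).congr_fun e1 measurableSet_Ioi
  have i2 : IntegrableOn f (Iic 0) := by
    refine IntegrableOn.congr_fun ?_ e2 measurableSet_Iic
    have h : IntegrableOn g (Ici 0) :=
      (integrableOn_Ici_iff_integrableOn_Ioi (by simp)).2
        (integrableOn_quadratic_mul_exp hr a' b' c')
    have := h.comp_neg
    rwa [neg_Ici, neg_zero] at this
  refine ⟨?_, ?_⟩
  · rw [← integrableOn_univ, ← Iic_union_Ioi (a := (0 : ℝ))]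
    exact i2.union i1
  · rw [← intervalIntegral.integral_Iic_add_Ioi i2 i1,
      ← setIntegral_congr_fun measurableSet_Ioi e1,
      ← setIntegral_congr_fun measurableSet_Iic e2, integral_comp_neg_Iic, neg_zero,
      integral_quadratic_mul_exp hr, integral_quadratic_mul_exp hr]
    ring

theorem integral_eq_of_two_sided {f : ℝ → ℝ} {r : ℝ} (hr : 0 < r) (C a b c a' b' c' : ℝ)
    (hf : ∀ x, f x = C * (Real.exp (-(r * |x|)) *
      (if 0 < x then a + b * |x| + c * |x| ^ 2 else a' + b' * |x| + c' * |x| ^ 2))) :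
    Integrable f ∧
      ∫ x, f x = C * ((a + a') / r + (b + b') / r ^ 2 + 2 * (c + c') / r ^ 3) := by
  have key := integral_two_sided hr a b c a' b' c'
  rw [funext hf]
  exact ⟨key.1.const_mul C, by rw [integral_const_mul, key.2]⟩

end Laplace

section Frequency

variable {m η τ : ℝ}

theorem ne_zero_of_sq_sub_sq (h : η ^ 2 - τ ^ 2 = 4) : η ≠ 0 := by
  rintro rfl; nlinarith [sq_nonneg τ]

theorem abs_ratio_lt_one (h : η ^ 2 - τ ^ 2 = 4) : |τ / η| < 1 := by
  rw [abs_div, div_lt_one (abs_pos.2 (ne_zero_of_sq_sub_sq h)), ← sq_lt_sq]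
  linarith

theorem one_sub_ratio_pos (h : η ^ 2 - τ ^ 2 = 4) : 0 < 1 - τ / η := by
  linarith [(abs_lt.1 (abs_ratio_lt_one h)).2]

theorem one_add_ratio_pos (h : η ^ 2 - τ ^ 2 = 4) : 0 < 1 + τ / η := by
  linarith [(abs_lt.1 (abs_ratio_lt_one h)).1]

theorem mass_term_pos (hm : 0 < m) (hη : η ≠ 0) : 0 < 4 * m ^ 2 / η ^ 2 := by positivity

theorem freq_sq (m η k : ℝ) : freq m η k ^ 2 = k ^ 2 + 4 * m ^ 2 / η ^ 2 :=
  Real.sq_sqrt (by positivity)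

theorem freq_pos (hm : 0 < m) (hη : η ≠ 0) (k : ℝ) : 0 < freq m η k := by
  have := mass_term_pos hm hη
  exact Real.sqrt_pos.2 (by positivity)

theorem abs_lt_freq (hm : 0 < m) (hη : η ≠ 0) (k : ℝ) : |k| < freq m η k := by
  rw [← abs_of_pos (freq_pos hm hη k), ← sq_lt_sq, freq_sq]
  linarith [mass_term_pos hm hη]

theorem freq_add_pos (hm : 0 < m) (hη : η ≠ 0) (k : ℝ) : 0 < freq m η k + k := by
  linarith [(abs_lt.1 (abs_lt_freq hm hη k)).1]

theorem freq_sub_pos (hm : 0 < m) (hη : η ≠ 0) (k : ℝ) : 0 < freq m η k - k := by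
  linarith [(abs_lt.1 (abs_lt_freq hm hη k)).2]

theorem le_freq (m η k : ℝ) : freq m η 0 ≤ freq m η k := by
  refine Real.sqrt_le_sqrt ?_
  nlinarith [sq_nonneg k]

theorem contDiff_freq (hm : 0 < m) (hη : η ≠ 0) : ContDiff ℝ ∞ (freq m η) := by
  have := mass_term_pos hm hη
  exact ((contDiff_id.pow 2).add contDiff_const).sqrt fun k => by
    simp only [id]; positivity

theorem hasDerivAt_freq (hm : 0 < m) (hη : η ≠ 0) (k : ℝ) :
    HasDerivAt (freq m η) (k / freq m η k) k := by
  have := mass_term_pos hm hη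
  have h0 : k ^ 2 + 4 * m ^ 2 / η ^ 2 ≠ 0 := by positivity
  have h : HasDerivAt (freq m η) _ k :=
    ((hasDerivAt_pow 2 k).add_const (4 * m ^ 2 / η ^ 2)).sqrt h0
  convert h using 1
  rw [show √(k ^ 2 + 4 * m ^ 2 / η ^ 2) = freq m η k from rfl]
  have := (freq_pos hm hη k).ne'
  field_simp
  simp [mul_comm]

end Frequency

section Amplitude

variable {m η τ : ℝ}

/-- First component of the spinor `A` for which `ψ_Ξ(x, y) = ∫ e^{iky} Ξ(k) A(x, k) dk`, with
weights `a` and `b` on the terms containing `√(ω + k)` and `√(ω - k)`, respectively. -/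
def upper (m η τ a b x k : ℝ) : ℝ :=
  1 / (2 * √Real.pi) * Real.exp (-(freq m η k * |x|)) *
    if 0 < x then -(η / |η|) * √((1 - τ / η) * (freq m η k - k)) * b
    else √((1 - τ / η) * (freq m η k + k)) * a

/-- The second component of the same spinor, up to the factor `-i`. -/
def lower (m η τ a b x k : ℝ) : ℝ :=
  1 / (2 * √Real.pi) * Real.exp (-(freq m η k * |x|)) *
    if 0 < x then (η / |η|) * √((1 + τ / η) * (freq m η k + k)) * a
    else √((1 + τ / η) * (freq m η k - k)) * b

/-- The spinor with components `upper` and `-i lower`. -/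
def amplitude (m η τ a b : ℝ) (p : ℝ × ℝ) : Spinor :=
  !₂[(upper m η τ a b p.1 p.2 : ℂ), -I * (lower m η τ a b p.1 p.2 : ℂ)]

theorem sign_mul_self (hη : η ≠ 0) : (η / |η|) * (η / |η|) = 1 := by
  have : |η| ≠ 0 := abs_ne_zero.2 hη
  field_simp
  rw [sq_abs]

theorem upper_mul (hm : 0 < m) (h : η ^ 2 - τ ^ 2 = 4) (a b a' b' x k : ℝ) :
    upper m η τ a b x k * upper m η τ a' b' x k
      = 1 / (4 * Real.pi) * (Real.exp (-(2 * freq m η k * |x|)) *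
        if 0 < x then (1 - τ / η) * (freq m η k - k) * (b * b')
        else (1 - τ / η) * (freq m η k + k) * (a * a')) := by
  have hη := ne_zero_of_sq_sub_sq h
  have e1 : Real.exp (-(2 * freq m η k * |x|)) = Real.exp (-(freq m η k * |x|)) ^ 2 := by
    rw [← Real.exp_nat_mul]; congr 1; push_cast; ring
  have e2 : 1 / (4 * Real.pi) = (1 / (2 * √Real.pi)) ^ 2 := by
    rw [div_pow, mul_pow, Real.sq_sqrt Real.pi_pos.le]; norm_num
  have e3 := Real.sq_sqrt (mul_pos (one_sub_ratio_pos h) (freq_sub_pos hm hη k)).le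
  have e4 := Real.sq_sqrt (mul_pos (one_sub_ratio_pos h) (freq_add_pos hm hη k)).le
  have e5 := sign_mul_self hη
  rw [e1, e2, upper, upper]
  split_ifs
  · linear_combination (1 / (2 * √Real.pi)) ^ 2 * Real.exp (-(freq m η k * |x|)) ^ 2 * (b * b') *
      (√((1 - τ / η) * (freq m η k - k)) ^ 2 * e5 + e3)
  · linear_combination (1 / (2 * √Real.pi)) ^ 2 * Real.exp (-(freq m η k * |x|)) ^ 2 *
      (a * a') * e4

theorem lower_mul (hm : 0 < m) (h : η ^ 2 - τ ^ 2 = 4) (a b a' b' x k : ℝ) :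
    lower m η τ a b x k * lower m η τ a' b' x k
      = 1 / (4 * Real.pi) * (Real.exp (-(2 * freq m η k * |x|)) *
        if 0 < x then (1 + τ / η) * (freq m η k + k) * (a * a')
        else (1 + τ / η) * (freq m η k - k) * (b * b')) := by
  have hη := ne_zero_of_sq_sub_sq h
  have e1 : Real.exp (-(2 * freq m η k * |x|)) = Real.exp (-(freq m η k * |x|)) ^ 2 := by
    rw [← Real.exp_nat_mul]; congr 1; push_cast; ring
  have e2 : 1 / (4 * Real.pi) = (1 / (2 * √Real.pi)) ^ 2 := by
    rw [div_pow, mul_pow, Real.sq_sqrt Real.pi_pos.le]; norm_num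
  have e3 := Real.sq_sqrt (mul_pos (one_add_ratio_pos h) (freq_sub_pos hm hη k)).le
  have e4 := Real.sq_sqrt (mul_pos (one_add_ratio_pos h) (freq_add_pos hm hη k)).le
  have e5 := sign_mul_self hη
  rw [e1, e2, lower, lower]
  split_ifs
  · linear_combination (1 / (2 * √Real.pi)) ^ 2 * Real.exp (-(freq m η k * |x|)) ^ 2 * (a * a') *
      (√((1 + τ / η) * (freq m η k + k)) ^ 2 * e5 + e4)
  · linear_combination (1 / (2 * √Real.pi)) ^ 2 * Real.exp (-(freq m η k * |x|)) ^ 2 *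
      (b * b') * e3

theorem inner_pair (u v u' v' : ℝ) :
    inner ℂ (!₂[(u : ℂ), -I * (v : ℂ)] : Spinor) !₂[(u' : ℂ), -I * (v' : ℂ)]
      = ((u * u' + v * v' : ℝ) : ℂ) := by
  simp [PiLp.inner_apply, Fin.sum_univ_two]
  linear_combination (-(v : ℂ) * v') * Complex.I_sq

theorem inner_amplitude (a b a' b' : ℝ) (p : ℝ × ℝ) :
    inner ℂ (amplitude m η τ a b p) (amplitude m η τ a' b' p)
      = ((upper m η τ a b p.1 p.2 * upper m η τ a' b' p.1 p.2
        + lower m η τ a b p.1 p.2 * lower m η τ a' b' p.1 p.2 : ℝ) : ℂ) :=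
  inner_pair _ _ _ _

theorem norm_sq_amplitude (a b : ℝ) (p : ℝ × ℝ) :
    ‖amplitude m η τ a b p‖ ^ 2
      = upper m η τ a b p.1 p.2 * upper m η τ a b p.1 p.2
        + lower m η τ a b p.1 p.2 * lower m η τ a b p.1 p.2 := by
  have h := inner_amplitude (m := m) (η := η) (τ := τ) a b a b p
  rw [inner_self_eq_norm_sq_to_K] at h
  exact Complex.ofReal_injective ((Complex.ofReal_pow _ 2).trans h)

/-- Integration over `x` of a product of two weighted amplitudes, for weights affine in `|x|`. -/
theorem integral_upper_lower (hm : 0 < m) (h : η ^ 2 - τ ^ 2 = 4) (k a₀ a₁ b₀ b₁ c₀ c₁ d₀ d₁ : ℝ) :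
    Integrable (fun x => upper m η τ (a₀ + a₁ * |x|) (b₀ + b₁ * |x|) x k *
        upper m η τ (c₀ + c₁ * |x|) (d₀ + d₁ * |x|) x k
      + lower m η τ (a₀ + a₁ * |x|) (b₀ + b₁ * |x|) x k *
        lower m η τ (c₀ + c₁ * |x|) (d₀ + d₁ * |x|) x k) ∧
    ∫ x, (upper m η τ (a₀ + a₁ * |x|) (b₀ + b₁ * |x|) x k *
        upper m η τ (c₀ + c₁ * |x|) (d₀ + d₁ * |x|) x k
      + lower m η τ (a₀ + a₁ * |x|) (b₀ + b₁ * |x|) x k *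
        lower m η τ (c₀ + c₁ * |x|) (d₀ + d₁ * |x|) x k)
      = 1 / (2 * Real.pi) *
        ((freq m η k + k) * (a₀ * c₀ / (2 * freq m η k)
            + (a₀ * c₁ + a₁ * c₀) / (2 * freq m η k) ^ 2 + 2 * (a₁ * c₁) / (2 * freq m η k) ^ 3)
          + (freq m η k - k) * (b₀ * d₀ / (2 * freq m η k)
            + (b₀ * d₁ + b₁ * d₀) / (2 * freq m η k) ^ 2
            + 2 * (b₁ * d₁) / (2 * freq m η k) ^ 3)) := by
  have hpos := freq_pos hm (ne_zero_of_sq_sub_sq h) k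
  have key := integral_eq_of_two_sided (r := 2 * freq m η k)
    (f := fun x => upper m η τ (a₀ + a₁ * |x|) (b₀ + b₁ * |x|) x k *
        upper m η τ (c₀ + c₁ * |x|) (d₀ + d₁ * |x|) x k
      + lower m η τ (a₀ + a₁ * |x|) (b₀ + b₁ * |x|) x k *
        lower m η τ (c₀ + c₁ * |x|) (d₀ + d₁ * |x|) x k) (by positivity) (1 / (4 * Real.pi))
    ((1 - τ / η) * (freq m η k - k) * (b₀ * d₀) + (1 + τ / η) * (freq m η k + k) * (a₀ * c₀))
    ((1 - τ / η) * (freq m η k - k) * (b₀ * d₁ + b₁ * d₀)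
      + (1 + τ / η) * (freq m η k + k) * (a₀ * c₁ + a₁ * c₀))
    ((1 - τ / η) * (freq m η k - k) * (b₁ * d₁) + (1 + τ / η) * (freq m η k + k) * (a₁ * c₁))
    ((1 - τ / η) * (freq m η k + k) * (a₀ * c₀) + (1 + τ / η) * (freq m η k - k) * (b₀ * d₀))
    ((1 - τ / η) * (freq m η k + k) * (a₀ * c₁ + a₁ * c₀)
      + (1 + τ / η) * (freq m η k - k) * (b₀ * d₁ + b₁ * d₀))
    ((1 - τ / η) * (freq m η k + k) * (a₁ * c₁) + (1 + τ / η) * (freq m η k - k) * (b₁ * d₁))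
    (fun x => by
      simp only [upper_mul hm h, lower_mul hm h]
      split_ifs <;> ring)
  refine ⟨key.1, key.2.trans ?_⟩
  have := Real.pi_ne_zero
  generalize τ / η = t
  field_simp
  ring

/-- The expectation of the spin in the unweighted amplitude. -/
theorem integral_upper_sub_lower (hm : 0 < m) (h : η ^ 2 - τ ^ 2 = 4) (k : ℝ) :
    ∫ x, (upper m η τ 1 1 x k * upper m η τ 1 1 x k - lower m η τ 1 1 x k * lower m η τ 1 1 x k)
      = -(τ / η) / (2 * Real.pi) := by
  have hpos := freq_pos hm (ne_zero_of_sq_sub_sq h) k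
  have key := integral_eq_of_two_sided (r := 2 * freq m η k)
    (f := fun x => upper m η τ 1 1 x k * upper m η τ 1 1 x k
      - lower m η τ 1 1 x k * lower m η τ 1 1 x k) (by positivity) (1 / (4 * Real.pi))
    ((1 - τ / η) * (freq m η k - k) - (1 + τ / η) * (freq m η k + k)) 0 0
    ((1 - τ / η) * (freq m η k + k) - (1 + τ / η) * (freq m η k - k)) 0 0
    (fun x => by
      simp only [upper_mul hm h, lower_mul hm h]
      split_ifs <;> ring)
  rw [key.2]
  have := Real.pi_ne_zero
  generalize τ / η = t
  field_simp
  ring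

theorem integral_mul_upper_lower (hm : 0 < m) (h : η ^ 2 - τ ^ 2 = 4) (k : ℝ) :
    ∫ x, x * (upper m η τ 1 1 x k * upper m η τ 1 1 x k
      + lower m η τ 1 1 x k * lower m η τ 1 1 x k)
      = τ / (2 * η) * (k / (k ^ 2 + 4 * m ^ 2 / η ^ 2)) / (2 * Real.pi) := by
  have hpos := freq_pos hm (ne_zero_of_sq_sub_sq h) k
  have key := integral_eq_of_two_sided (r := 2 * freq m η k)
    (f := fun x => x * (upper m η τ 1 1 x k * upper m η τ 1 1 x k
      + lower m η τ 1 1 x k * lower m η τ 1 1 x k)) (by positivity) (1 / (4 * Real.pi))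
    0 ((1 - τ / η) * (freq m η k - k) + (1 + τ / η) * (freq m η k + k)) 0
    0 (-((1 - τ / η) * (freq m η k + k) + (1 + τ / η) * (freq m η k - k))) 0
    (fun x => by
      simp only [upper_mul hm h, lower_mul hm h]
      split_ifs with hx
      · rw [abs_of_pos hx]; ring
      · rw [abs_of_nonpos (not_lt.1 hx)]; ring)
  rw [key.2, ← freq_sq]
  have := Real.pi_ne_zero
  have := ne_zero_of_sq_sub_sq h
  field_simp
  ring

theorem sqrt_mul_sqrt_eq (hm : 0 < m) (h : η ^ 2 - τ ^ 2 = 4) (k : ℝ) :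
    √((1 - τ / η) * (freq m η k - k)) * √((1 + τ / η) * (freq m η k + k))
      = √((1 - τ / η) * (freq m η k + k)) * √((1 + τ / η) * (freq m η k - k)) := by
  have hη := ne_zero_of_sq_sub_sq h
  rw [← Real.sqrt_mul (mul_pos (one_sub_ratio_pos h) (freq_sub_pos hm hη k)).le,
    ← Real.sqrt_mul (mul_pos (one_sub_ratio_pos h) (freq_add_pos hm hη k)).le]
  congr 1; ring

theorem integral_upper_mul_lower (hm : 0 < m) (h : η ^ 2 - τ ^ 2 = 4) (k : ℝ) :
    ∫ x, upper m η τ 1 1 x k * lower m η τ 1 1 x k = 0 := by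
  have hη := ne_zero_of_sq_sub_sq h
  have hpos := freq_pos hm hη k
  have e5 := sign_mul_self hη
  have key := integral_eq_of_two_sided (r := 2 * freq m η k)
    (f := fun x => upper m η τ 1 1 x k * lower m η τ 1 1 x k) (by positivity)
    ((1 / (2 * √Real.pi)) ^ 2 *
      (√((1 - τ / η) * (freq m η k + k)) * √((1 + τ / η) * (freq m η k - k))))
    (-1) 0 0 1 0 0
    (fun x => by
      have e1 : Real.exp (-(2 * freq m η k * |x|)) = Real.exp (-(freq m η k * |x|)) ^ 2 := by
        rw [← Real.exp_nat_mul]; congr 1; push_cast; ring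
      have e2 := sqrt_mul_sqrt_eq hm h k
      simp only [upper, lower, e1]
      split_ifs
      · linear_combination (-(1 / (2 * √Real.pi)) ^ 2 * Real.exp (-(freq m η k * |x|)) ^ 2) *
          (e2 + √((1 - τ / η) * (freq m η k - k)) * √((1 + τ / η) * (freq m η k + k)) * e5)
      · ring)
  rw [key.2]; simp

end Amplitude

section Fibres

/-- Square integrability of `(x, k) ↦ f(k) P(x, k)` in terms of the integral of `‖P(x, k)‖²`
over `x`. -/
theorem memLp_smul_iff {F : Type*} [NormedAddCommGroup F] [NormedSpace ℂ F] {P : ℝ × ℝ → F}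
    (hP : StronglyMeasurable P) {f : ℝ → ℂ} (hf : AEStronglyMeasurable f)
    (hi : ∀ k, Integrable (fun x => ‖P (x, k)‖ ^ 2)) :
    MemLp (fun p => f p.2 • P p) 2 volume
      ↔ Integrable (fun k => ‖f k‖ ^ 2 * ∫ x, ‖P (x, k)‖ ^ 2) := by
  have hm : AEStronglyMeasurable (fun p : ℝ × ℝ => f p.2 • P p) :=
    (hf.comp_quasiMeasurePreserving Measure.quasiMeasurePreserving_snd).smul
      hP.aestronglyMeasurable
  rw [memLp_two_iff_integrable_sq_norm hm]
  have hm2 : AEStronglyMeasurable (fun p : ℝ × ℝ => ‖f p.2 • P p‖ ^ 2) := hm.norm.pow 2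
  rw [Measure.volume_eq_prod] at hm2 ⊢
  have e : (fun k => ∫ x, ‖(‖f k • P (x, k)‖ ^ 2)‖)
      = fun k => ‖f k‖ ^ 2 * ∫ x, ‖P (x, k)‖ ^ 2 := by
    funext k
    rw [← integral_const_mul]
    congr 1; funext x
    rw [Real.norm_of_nonneg (by positivity), norm_smul, mul_pow]
  rw [integrable_prod_iff' hm2]
  simp only
  rw [e, and_iff_right]
  refine Filter.Eventually.of_forall fun k => ?_
  refine ((hi k).const_mul (‖f k‖ ^ 2)).congr (Filter.Eventually.of_forall fun x => ?_)
  simp only [norm_smul, mul_pow]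

theorem integral_inner_smul {F : Type*} [NormedAddCommGroup F] [InnerProductSpace ℂ F]
    {P Q : ℝ × ℝ → F} {f g : ℝ → ℂ}
    (hP : MemLp (fun p => f p.2 • P p) 2 volume) (hQ : MemLp (fun p => g p.2 • Q p) 2 volume) :
    ∫ p : ℝ × ℝ, inner ℂ (f p.2 • P p) (g p.2 • Q p)
      = ∫ k, inner ℂ (f k) (g k) * ∫ x, inner ℂ (P (x, k)) (Q (x, k)) := by
  have h := integrable_inner_of_memLp hP hQ
  rw [Measure.volume_eq_prod] at h ⊢
  rw [integral_prod_symm _ h]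
  congr 1; funext k
  rw [← integral_const_mul]
  congr 1; funext x
  simp only [inner_smul_left, inner_smul_right, RCLike.inner_apply]
  ring

end Fibres

section AmplitudeIntegrability

variable {m η τ : ℝ}

theorem continuous_freq (m η : ℝ) : Continuous (freq m η) := by
  unfold freq; fun_prop

theorem measurable_upper {α : Type*} [MeasurableSpace α] {a b x k : α → ℝ} (ha : Measurable a)
    (hb : Measurable b) (hx : Measurable x) (hk : Measurable k) :
    Measurable (fun p => upper m η τ (a p) (b p) (x p) (k p)) := by
  have := (continuous_freq m η).measurable.comp hk
  unfold upper
  refine Measurable.mul (by fun_prop) (Measurable.ite (measurableSet_lt measurable_const hx) ?_ ?_)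
  all_goals fun_prop

theorem measurable_lower {α : Type*} [MeasurableSpace α] {a b x k : α → ℝ} (ha : Measurable a)
    (hb : Measurable b) (hx : Measurable x) (hk : Measurable k) :
    Measurable (fun p => lower m η τ (a p) (b p) (x p) (k p)) := by
  have := (continuous_freq m η).measurable.comp hk
  unfold lower
  refine Measurable.mul (by fun_prop) (Measurable.ite (measurableSet_lt measurable_const hx) ?_ ?_)
  all_goals fun_prop

theorem stronglyMeasurable_amplitude {a b : ℝ × ℝ → ℝ} (ha : Measurable a) (hb : Measurable b) :
    StronglyMeasurable (fun p => amplitude m η τ (a p) (b p) p) := by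
  refine Measurable.stronglyMeasurable ?_
  have h1 := measurable_upper (m := m) (η := η) (τ := τ) ha hb measurable_fst measurable_snd
  have h2 := measurable_lower (m := m) (η := η) (τ := τ) ha hb measurable_fst measurable_snd
  refine (WithLp.measurable_toLp 2 (Fin 2 → ℂ)).comp (measurable_pi_iff.2 fun i => ?_)
  fin_cases i
  · exact Complex.measurable_ofReal.comp h1
  · exact (Complex.measurable_ofReal.comp h2).const_mul (-I)

theorem mul_exp_le {w r : ℝ} (hr : 0 < r) :
    w * Real.exp (-(2 * w * r)) ≤ 1 / r * Real.exp (-(w * r)) := by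
  have h1 : w * r ≤ Real.exp (w * r) := by linarith [Real.add_one_le_exp (w * r)]
  have h2 : Real.exp (-(2 * w * r)) = Real.exp (-(w * r)) * Real.exp (-(w * r)) := by
    rw [← Real.exp_add]; congr 1; ring
  have h3 : Real.exp (w * r) * Real.exp (-(w * r)) = 1 := by rw [← Real.exp_add]; simp
  have h4 : w * Real.exp (-(2 * w * r)) = 1 / r * (w * r * Real.exp (-(w * r)))
      * Real.exp (-(w * r)) := by rw [h2]; field_simp
  rw [h4]
  refine mul_le_mul_of_nonneg_right ?_ (Real.exp_pos _).le
  calc 1 / r * (w * r * Real.exp (-(w * r)))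
      ≤ 1 / r * (Real.exp (w * r) * Real.exp (-(w * r))) := by gcongr
    _ = 1 / r := by rw [h3, mul_one]

theorem integrable_exp_neg_mul_abs {r : ℝ} (hr : 0 < r) :
    Integrable (fun k : ℝ => Real.exp (-(r * |k|))) := by
  simpa using (integral_two_sided hr 1 0 0 1 0 0).1

theorem exp_freq_le (hm : 0 < m) (hη : η ≠ 0) {x : ℝ} (hx : x ≠ 0) (k : ℝ) :
    freq m η k * Real.exp (-(2 * freq m η k * |x|)) ≤ 1 / |x| * Real.exp (-(|x| * |k|)) := by
  have hx' := abs_pos.2 hx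
  refine (mul_exp_le hx').trans ?_
  have := (abs_lt_freq hm hη k).le
  gcongr 1 / |x| * Real.exp (-?_)
  rw [mul_comm]; gcongr

theorem memLp_two_of_sq_le {f : ℝ → ℝ} (hf : Measurable f) {r C : ℝ} (hr : 0 < r)
    (h : ∀ k, f k * f k ≤ C * Real.exp (-(r * |k|))) : MemLp f 2 volume := by
  rw [memLp_two_iff_integrable_sq hf.aestronglyMeasurable]
  refine Integrable.mono' ((integrable_exp_neg_mul_abs hr).const_mul C)
    (hf.pow_const 2).aestronglyMeasurable (Filter.Eventually.of_forall fun k => ?_)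
  rw [Real.norm_of_nonneg (sq_nonneg _), sq]
  exact h k

theorem weight_le {w k t s c C : ℝ} (ht : |t| < 1) (hk : |k| < w) (hs : |s| = 1) (hc : |c| ≤ C) :
    (1 + t) * (w + s * k) * (c * c) ≤ 4 * C ^ 2 * w := by
  obtain ⟨t1, t2⟩ := abs_lt.1 ht
  have hsk : |s * k| < w := by rwa [abs_mul, hs, one_mul]
  obtain ⟨k1, k2⟩ := abs_lt.1 hsk
  have hcc : c * c ≤ C ^ 2 := by rw [← sq, ← sq_abs]; gcongr
  have hw : 0 < w := (abs_nonneg k).trans_lt hk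
  calc (1 + t) * (w + s * k) * (c * c) ≤ 2 * (2 * w) * C ^ 2 := by
        refine mul_le_mul (mul_le_mul ?_ ?_ ?_ ?_) hcc (mul_self_nonneg c) ?_ <;> nlinarith
    _ = _ := by ring

theorem memLp_upper (hm : 0 < m) (h : η ^ 2 - τ ^ 2 = 4) {x : ℝ} (hx : x ≠ 0) {a b : ℝ → ℝ}
    (ha : Measurable a) (hb : Measurable b) {C : ℝ} (haC : ∀ k, |a k| ≤ C) (hbC : ∀ k, |b k| ≤ C) :
    MemLp (fun k => upper m η τ (a k) (b k) x k) 2 volume := by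
  have hη := ne_zero_of_sq_sub_sq h
  refine memLp_two_of_sq_le (C := 1 / (4 * Real.pi) * (4 * C ^ 2 * (1 / |x|))) (r := |x|)
    (measurable_upper ha hb measurable_const measurable_id) (abs_pos.2 hx) fun k => ?_
  rw [upper_mul hm h, mul_assoc (1 / (4 * Real.pi))]
  refine mul_le_mul_of_nonneg_left ?_ (by positivity)
  have ht : |-(τ / η)| < 1 := by rw [abs_neg]; exact abs_ratio_lt_one h
  have hk := abs_lt_freq hm hη k
  have w1 := weight_le (s := -1) ht hk (by simp) (hbC k)
  have w2 := weight_le (s := 1) ht hk (by simp) (haC k)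
  calc _ ≤ Real.exp (-(2 * freq m η k * |x|)) * (4 * C ^ 2 * freq m η k) := by
        refine mul_le_mul_of_nonneg_left ?_ (Real.exp_pos _).le
        split_ifs
        · linarith
        · linarith
    _ = 4 * C ^ 2 * (freq m η k * Real.exp (-(2 * freq m η k * |x|))) := by ring
    _ ≤ 4 * C ^ 2 * (1 / |x| * Real.exp (-(|x| * |k|))) :=
      mul_le_mul_of_nonneg_left (exp_freq_le hm hη hx k) (by positivity)
    _ = _ := by ring

theorem memLp_lower (hm : 0 < m) (h : η ^ 2 - τ ^ 2 = 4) {x : ℝ} (hx : x ≠ 0) {a b : ℝ → ℝ}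
    (ha : Measurable a) (hb : Measurable b) {C : ℝ} (haC : ∀ k, |a k| ≤ C) (hbC : ∀ k, |b k| ≤ C) :
    MemLp (fun k => lower m η τ (a k) (b k) x k) 2 volume := by
  have hη := ne_zero_of_sq_sub_sq h
  refine memLp_two_of_sq_le (C := 1 / (4 * Real.pi) * (4 * C ^ 2 * (1 / |x|))) (r := |x|)
    (measurable_lower ha hb measurable_const measurable_id) (abs_pos.2 hx) fun k => ?_
  rw [lower_mul hm h, mul_assoc (1 / (4 * Real.pi))]
  refine mul_le_mul_of_nonneg_left ?_ (by positivity)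
  have ht := abs_ratio_lt_one h
  have hk := abs_lt_freq hm hη k
  have w1 := weight_le (s := 1) ht hk (by simp) (haC k)
  have w2 := weight_le (s := -1) ht hk (by simp) (hbC k)
  calc _ ≤ Real.exp (-(2 * freq m η k * |x|)) * (4 * C ^ 2 * freq m η k) := by
        refine mul_le_mul_of_nonneg_left ?_ (Real.exp_pos _).le
        split_ifs
        · linarith
        · linarith
    _ = 4 * C ^ 2 * (freq m η k * Real.exp (-(2 * freq m η k * |x|))) := by ring
    _ ≤ 4 * C ^ 2 * (1 / |x| * Real.exp (-(|x| * |k|))) :=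
      mul_le_mul_of_nonneg_left (exp_freq_le hm hη hx k) (by positivity)
    _ = _ := by ring

theorem integrable_mul_upper (hm : 0 < m) (h : η ^ 2 - τ ^ 2 = 4) {x : ℝ} (hx : x ≠ 0)
    {a b : ℝ → ℝ} (ha : Measurable a) (hb : Measurable b) {C : ℝ} (haC : ∀ k, |a k| ≤ C)
    (hbC : ∀ k, |b k| ≤ C) {f : ℝ → ℂ} (hf : MemLp f 2 volume) :
    Integrable (fun k => f k * (upper m η τ (a k) (b k) x k : ℂ)) :=
  hf.integrable_mul (memLp_upper hm h hx ha hb haC hbC).ofReal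

theorem integrable_mul_lower (hm : 0 < m) (h : η ^ 2 - τ ^ 2 = 4) {x : ℝ} (hx : x ≠ 0)
    {a b : ℝ → ℝ} (ha : Measurable a) (hb : Measurable b) {C : ℝ} (haC : ∀ k, |a k| ≤ C)
    (hbC : ∀ k, |b k| ≤ C) {f : ℝ → ℂ} (hf : MemLp f 2 volume) :
    Integrable (fun k => f k * (-I * (lower m η τ (a k) (b k) x k : ℂ))) := by
  have := (hf.integrable_mul (memLp_lower hm h hx ha hb haC hbC).ofReal).const_mul (-I)
  refine this.congr (Filter.Eventually.of_forall fun k => ?_)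
  simp only [Pi.mul_apply]
  exact mul_left_comm _ _ _

theorem integrable_spinor {f : ℝ → Spinor} (h : ∀ i, Integrable (fun k => f k i)) :
    Integrable f := by
  have := (Integrable.of_eval h : Integrable (fun k => (f k).ofLp))
  exact (EuclideanSpace.equiv (Fin 2) ℂ).symm.toContinuousLinearMap.integrable_comp this

theorem integrable_smul_amplitude (hm : 0 < m) (h : η ^ 2 - τ ^ 2 = 4) {x : ℝ} (hx : x ≠ 0)
    {a b : ℝ → ℝ} (ha : Measurable a) (hb : Measurable b) {C : ℝ} (haC : ∀ k, |a k| ≤ C)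
    (hbC : ∀ k, |b k| ≤ C) {f : ℝ → ℂ} (hf : MemLp f 2 volume) :
    Integrable (fun k => f k • amplitude m η τ (a k) (b k) (x, k)) := by
  refine integrable_spinor fun i => ?_
  fin_cases i
  · exact integrable_mul_upper hm h hx ha hb haC hbC hf
  · exact integrable_mul_lower hm h hx ha hb haC hbC hf

end AmplitudeIntegrability

section AmplitudeDerivative

variable {m η τ : ℝ}

theorem contDiff_sqrt_mul_freq_add (hm : 0 < m) (hη : η ≠ 0) {c s : ℝ} (hc : 0 < c)
    (hs : |s| = 1) : ContDiff ℝ ∞ (fun k => √(c * (freq m η k + s * k))) := by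
  refine (contDiff_const.mul ((contDiff_freq hm hη).add (contDiff_const.mul contDiff_id))).sqrt
    fun k => ?_
  have h1 : |s * k| < freq m η k := by rw [abs_mul, hs, one_mul]; exact abs_lt_freq hm hη k
  have h2 := (abs_lt.1 h1).1
  exact (mul_pos hc (by simp only [id]; linarith)).ne'

theorem hasDerivAt_sqrt_mul_freq_add (hm : 0 < m) (hη : η ≠ 0) {c s : ℝ} (hc : 0 < c)
    (hs : s * s = 1) (k : ℝ) :
    HasDerivAt (fun k => √(c * (freq m η k + s * k)))
      (√(c * (freq m η k + s * k)) * (s / (2 * freq m η k))) k := by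
  have hs' : |s| = 1 := by
    rw [← sq_eq_sq₀ (abs_nonneg s) zero_le_one, sq_abs, sq, hs, one_pow]
  have h1 : |s * k| < freq m η k := by rw [abs_mul, hs', one_mul]; exact abs_lt_freq hm hη k
  have h2 : 0 < freq m η k + s * k := by linarith [(abs_lt.1 h1).1]
  have hpos := freq_pos hm hη k
  have hd := (((hasDerivAt_freq hm hη k).add ((hasDerivAt_id k).const_mul s)).const_mul c).sqrt
    (mul_pos hc h2).ne'
  have hsq := Real.sq_sqrt (mul_pos hc h2).le
  have hne := (Real.sqrt_pos.2 (mul_pos hc h2)).ne'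
  refine hd.congr_deriv ?_
  simp only [Pi.add_apply, id, mul_one]
  rw [div_eq_iff (by positivity)]
  set S := √(c * (freq m η k + s * k))
  have e : S * (s / (2 * freq m η k)) * (2 * S) = S ^ 2 * (s / freq m η k) := by
    field_simp
  rw [e, hsq]
  field_simp
  linear_combination (-k) * hs

theorem contDiff_exp_freq (hm : 0 < m) (hη : η ≠ 0) (x : ℝ) :
    ContDiff ℝ ∞ (fun k => 1 / (2 * √Real.pi) * Real.exp (-(freq m η k * |x|))) :=
  contDiff_const.mul (((contDiff_freq hm hη).mul contDiff_const).neg).exp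

theorem hasDerivAt_exp_freq (hm : 0 < m) (hη : η ≠ 0) (x k : ℝ) :
    HasDerivAt (fun k => 1 / (2 * √Real.pi) * Real.exp (-(freq m η k * |x|)))
      (1 / (2 * √Real.pi) * Real.exp (-(freq m η k * |x|)) * (-(k / freq m η k) * |x|)) k := by
  have := ((((hasDerivAt_freq hm hη k).mul_const |x|).neg).exp).const_mul (1 / (2 * √Real.pi))
  refine this.congr_deriv ?_
  simp only [Pi.neg_apply]
  ring

theorem contDiff_upper (hm : 0 < m) (h : η ^ 2 - τ ^ 2 = 4) (x : ℝ) :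
    ContDiff ℝ ∞ (fun k => upper m η τ 1 1 x k) := by
  have hη := ne_zero_of_sq_sub_sq h
  have h1 := contDiff_sqrt_mul_freq_add hm hη (s := 1) (one_sub_ratio_pos h) (by simp)
  have h2 := contDiff_sqrt_mul_freq_add hm hη (s := -1) (one_sub_ratio_pos h) (by simp)
  simp only [one_mul, neg_one_mul, ← sub_eq_add_neg] at h1 h2
  refine (contDiff_exp_freq hm hη x).mul ?_
  split_ifs
  · exact (contDiff_const.mul h2).mul contDiff_const
  · exact h1.mul contDiff_const

theorem contDiff_lower (hm : 0 < m) (h : η ^ 2 - τ ^ 2 = 4) (x : ℝ) :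
    ContDiff ℝ ∞ (fun k => lower m η τ 1 1 x k) := by
  have hη := ne_zero_of_sq_sub_sq h
  have h1 := contDiff_sqrt_mul_freq_add hm hη (s := 1) (one_add_ratio_pos h) (by simp)
  have h2 := contDiff_sqrt_mul_freq_add hm hη (s := -1) (one_add_ratio_pos h) (by simp)
  simp only [one_mul, neg_one_mul, ← sub_eq_add_neg] at h1 h2
  refine (contDiff_exp_freq hm hη x).mul ?_
  split_ifs
  · exact (contDiff_const.mul h1).mul contDiff_const
  · exact h2.mul contDiff_const

/-- Logarithmic derivative in `k` of `√(ω + k) e^{-ω|x|}`. -/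
def logDerivAdd (m η x k : ℝ) : ℝ := 1 / (2 * freq m η k) + -(k / freq m η k) * |x|

/-- Logarithmic derivative in `k` of `√(ω - k) e^{-ω|x|}`. -/
def logDerivSub (m η x k : ℝ) : ℝ := -1 / (2 * freq m η k) + -(k / freq m η k) * |x|

theorem hasDerivAt_upper (hm : 0 < m) (h : η ^ 2 - τ ^ 2 = 4) (x k : ℝ) :
    HasDerivAt (fun k => upper m η τ 1 1 x k)
      (upper m η τ (logDerivAdd m η x k) (logDerivSub m η x k) x k) k := by
  have hη := ne_zero_of_sq_sub_sq h
  have h0 := hasDerivAt_exp_freq hm hη x k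
  have h1 := hasDerivAt_sqrt_mul_freq_add hm hη (s := 1) (one_sub_ratio_pos h) (by simp) k
  have h2 := hasDerivAt_sqrt_mul_freq_add hm hη (s := -1) (one_sub_ratio_pos h) (by simp) k
  simp only [one_mul, neg_one_mul, ← sub_eq_add_neg] at h1 h2
  unfold upper logDerivAdd logDerivSub
  split_ifs
  · exact (h0.mul ((h2.const_mul (-(η / |η|))).mul_const 1)).congr_deriv (by ring)
  · exact (h0.mul (h1.mul_const 1)).congr_deriv (by ring)

theorem hasDerivAt_lower (hm : 0 < m) (h : η ^ 2 - τ ^ 2 = 4) (x k : ℝ) :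
    HasDerivAt (fun k => lower m η τ 1 1 x k)
      (lower m η τ (logDerivAdd m η x k) (logDerivSub m η x k) x k) k := by
  have hη := ne_zero_of_sq_sub_sq h
  have h0 := hasDerivAt_exp_freq hm hη x k
  have h1 := hasDerivAt_sqrt_mul_freq_add hm hη (s := 1) (one_add_ratio_pos h) (by simp) k
  have h2 := hasDerivAt_sqrt_mul_freq_add hm hη (s := -1) (one_add_ratio_pos h) (by simp) k
  simp only [one_mul, neg_one_mul, ← sub_eq_add_neg] at h1 h2
  unfold lower logDerivAdd logDerivSub
  split_ifs
  · exact (h0.mul ((h1.const_mul (η / |η|)).mul_const 1)).congr_deriv (by ring)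
  · exact (h0.mul (h2.mul_const 1)).congr_deriv (by ring)

theorem measurable_logDerivAdd (m η : ℝ) :
    Measurable (fun p : ℝ × ℝ => logDerivAdd m η p.1 p.2) := by
  have : Measurable (fun p : ℝ × ℝ => freq m η p.2) :=
    (continuous_freq m η).measurable.comp measurable_snd
  unfold logDerivAdd; fun_prop

theorem measurable_logDerivSub (m η : ℝ) :
    Measurable (fun p : ℝ × ℝ => logDerivSub m η p.1 p.2) := by
  have : Measurable (fun p : ℝ × ℝ => freq m η p.2) :=
    (continuous_freq m η).measurable.comp measurable_snd
  unfold logDerivSub; fun_prop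

theorem abs_logDeriv_le (hm : 0 < m) (hη : η ≠ 0) {s : ℝ} (hs : |s| = 1) (x k : ℝ) :
    |s / (2 * freq m η k) + (-(k / freq m η k) * |x|)| ≤ 1 / (2 * freq m η 0) + |x| := by
  have h0 := freq_pos hm hη 0
  have hk := freq_pos hm hη k
  refine (abs_add_le _ _).trans (add_le_add ?_ ?_)
  · rw [abs_div, hs, abs_of_pos (by positivity)]
    have := le_freq m η k
    gcongr
  · rw [abs_mul, abs_abs, abs_neg, abs_div, abs_of_pos hk]
    exact mul_le_of_le_one_left (abs_nonneg x) ((div_le_one hk).2 (abs_lt_freq hm hη k).le)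

end AmplitudeDerivative

section Fields

variable {m η τ : ℝ}

/-- The `k`-derivative of the amplitude. -/
def amplitudeDeriv (m η τ : ℝ) (p : ℝ × ℝ) : Spinor :=
  amplitude m η τ (logDerivAdd m η p.1 p.2) (logDerivSub m η p.1 p.2) p

theorem integral_norm_sq_amplitude (hm : 0 < m) (h : η ^ 2 - τ ^ 2 = 4) (k : ℝ) :
    Integrable (fun x => ‖amplitude m η τ 1 1 (x, k)‖ ^ 2) ∧
      ∫ x, ‖amplitude m η τ 1 1 (x, k)‖ ^ 2 = 1 / (2 * Real.pi) := by
  have key := integral_upper_lower hm h k 1 0 1 0 1 0 1 0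
  simp only [zero_mul, add_zero] at key
  simp only [norm_sq_amplitude]
  refine ⟨key.1, key.2.trans ?_⟩
  have := (freq_pos hm (ne_zero_of_sq_sub_sq h) k).ne'
  have := Real.pi_ne_zero
  field_simp; ring

theorem integral_norm_sq_amplitudeDeriv (hm : 0 < m) (h : η ^ 2 - τ ^ 2 = 4) (k : ℝ) :
    Integrable (fun x => ‖amplitudeDeriv m η τ (x, k)‖ ^ 2) ∧
      ∫ x, ‖amplitudeDeriv m η τ (x, k)‖ ^ 2
        = 1 / (2 * Real.pi) * (1 / 4 * (1 / √(k ^ 2 + 4 * m ^ 2 / η ^ 2)) ^ 2) := by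
  have key := integral_upper_lower hm h k (1 / (2 * freq m η k)) (-(k / freq m η k))
    (-1 / (2 * freq m η k)) (-(k / freq m η k)) (1 / (2 * freq m η k)) (-(k / freq m η k))
    (-1 / (2 * freq m η k)) (-(k / freq m η k))
  simp only [amplitudeDeriv, norm_sq_amplitude, logDerivAdd, logDerivSub]
  refine ⟨key.1, key.2.trans ?_⟩
  have := (freq_pos hm (ne_zero_of_sq_sub_sq h) k).ne'
  have := Real.pi_ne_zero
  rw [show √(k ^ 2 + 4 * m ^ 2 / η ^ 2) = freq m η k from rfl]
  field_simp; ring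

theorem integral_inner_amplitude_amplitudeDeriv (hm : 0 < m) (h : η ^ 2 - τ ^ 2 = 4) (k : ℝ) :
    ∫ x, inner ℂ (amplitude m η τ 1 1 (x, k)) (amplitudeDeriv m η τ (x, k)) = 0 := by
  have key := integral_upper_lower hm h k 1 0 1 0 (1 / (2 * freq m η k)) (-(k / freq m η k))
    (-1 / (2 * freq m η k)) (-(k / freq m η k))
  simp only [zero_mul, add_zero] at key
  simp only [amplitudeDeriv, inner_amplitude, logDerivAdd, logDerivSub]
  rw [integral_complex_ofReal, key.2, Complex.ofReal_eq_zero]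
  have := (freq_pos hm (ne_zero_of_sq_sub_sq h) k).ne'
  have := Real.pi_ne_zero
  field_simp; ring

theorem integral_inner_amplitudeDeriv_amplitude (hm : 0 < m) (h : η ^ 2 - τ ^ 2 = 4) (k : ℝ) :
    ∫ x, inner ℂ (amplitudeDeriv m η τ (x, k)) (amplitude m η τ 1 1 (x, k)) = 0 := by
  have e := congrArg (starRingEnd ℂ) (integral_inner_amplitude_amplitudeDeriv hm h k)
  rw [← integral_conj, map_zero] at e
  simpa only [inner_conj_symm] using e

theorem norm_sq_smul_amplitude (x k : ℝ) :
    ‖(x : ℂ) • amplitude m η τ 1 1 (x, k)‖ ^ 2 = ‖amplitude m η τ |x| |x| (x, k)‖ ^ 2 := by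
  rw [norm_smul, mul_pow, Complex.norm_real, Real.norm_eq_abs, norm_sq_amplitude,
    norm_sq_amplitude]
  simp only [upper, lower]
  split_ifs <;> ring

theorem integral_norm_sq_smul_amplitude (hm : 0 < m) (h : η ^ 2 - τ ^ 2 = 4) (k : ℝ) :
    Integrable (fun x : ℝ => ‖(x : ℂ) • amplitude m η τ 1 1 (x, k)‖ ^ 2) ∧
      ∫ x : ℝ, ‖(x : ℂ) • amplitude m η τ 1 1 (x, k)‖ ^ 2
        = 1 / (2 * Real.pi) * (1 / 2 * (1 / √(k ^ 2 + 4 * m ^ 2 / η ^ 2)) ^ 2) := by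
  have key := integral_upper_lower hm h k 0 1 0 1 0 1 0 1
  simp only [zero_add, one_mul] at key
  simp only [norm_sq_smul_amplitude, norm_sq_amplitude]
  refine ⟨key.1, key.2.trans ?_⟩
  have := (freq_pos hm (ne_zero_of_sq_sub_sq h) k).ne'
  have := Real.pi_ne_zero
  rw [show √(k ^ 2 + 4 * m ^ 2 / η ^ 2) = freq m η k from rfl]
  field_simp; ring

theorem integral_inner_smul_amplitude (hm : 0 < m) (h : η ^ 2 - τ ^ 2 = 4) (k : ℝ) :
    ∫ x : ℝ, inner ℂ (amplitude m η τ 1 1 (x, k)) ((x : ℂ) • amplitude m η τ 1 1 (x, k))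
      = 1 / (2 * Real.pi : ℝ) *
        ((τ : ℂ) / (2 * η) * ((k / (k ^ 2 + 4 * m ^ 2 / η ^ 2) : ℝ) : ℂ)) := by
  simp only [inner_smul_right, inner_amplitude, ← Complex.ofReal_mul]
  rw [integral_complex_ofReal, integral_mul_upper_lower hm h]
  push_cast; ring

theorem integral_inner_spin_amplitude (hm : 0 < m) (h : η ^ 2 - τ ^ 2 = 4) (k : ℝ) :
    ∫ x : ℝ, inner ℂ (amplitude m η τ 1 1 (x, k)) (act σ₃ (amplitude m η τ 1 1 (x, k)))
      = 1 / (2 * Real.pi : ℝ) * -((τ : ℂ) / η) := by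
  have e : ∀ x : ℝ, inner ℂ (amplitude m η τ 1 1 (x, k)) (act σ₃ (amplitude m η τ 1 1 (x, k)))
      = ((upper m η τ 1 1 x k * upper m η τ 1 1 x k
        - lower m η τ 1 1 x k * lower m η τ 1 1 x k : ℝ) : ℂ) := fun x => by
    simp [amplitude, act, σ₃, PiLp.inner_apply, Fin.sum_univ_two]
    linear_combination ((lower m η τ 1 1 x k : ℂ) * lower m η τ 1 1 x k) * Complex.I_sq
  simp only [e]
  rw [integral_complex_ofReal, integral_upper_sub_lower hm h]
  push_cast; ring

theorem inner_velX_amplitude (a b : ℝ) (p : ℝ × ℝ) :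
    inner ℂ (amplitude m η τ a b p) (act σ₁ (amplitude m η τ a b p)) = 0 := by
  simp [amplitude, act, σ₁, PiLp.inner_apply, Fin.sum_univ_two]
  ring

theorem integral_inner_velY_amplitude (hm : 0 < m) (h : η ^ 2 - τ ^ 2 = 4) (k : ℝ) :
    ∫ x : ℝ, inner ℂ (amplitude m η τ 1 1 (x, k)) (act σ₂ (amplitude m η τ 1 1 (x, k))) = 0 := by
  have e : ∀ x : ℝ, inner ℂ (amplitude m η τ 1 1 (x, k)) (act σ₂ (amplitude m η τ 1 1 (x, k)))
      = -2 * ((upper m η τ 1 1 x k * lower m η τ 1 1 x k : ℝ) : ℂ) := fun x => by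
    simp [amplitude, act, σ₂, PiLp.inner_apply, Fin.sum_univ_two]
    linear_combination (2 * (upper m η τ 1 1 x k : ℂ) * lower m η τ 1 1 x k) * Complex.I_sq
  simp only [e]
  rw [integral_const_mul, integral_complex_ofReal, integral_upper_mul_lower hm h]
  simp

end Fields

section Admissible

/-- Square integrable spinor fields whose fibres at `x ≠ 0` are integrable in `k`. -/
def Admissible (G : ℝ × ℝ → Spinor) : Prop :=
  MemLp G 2 volume ∧ ∀ x : ℝ, x ≠ 0 → Integrable (fun k => G (x, k))

/-- The action of a matrix on spinors as a continuous linear map. -/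
def actL (M : Matrix (Fin 2) (Fin 2) ℂ) : Spinor →L[ℂ] Spinor :=
  LinearMap.toContinuousLinearMap
    { toFun := act M, map_add' := act_add M, map_smul' := act_smul M }

theorem actL_apply (M : Matrix (Fin 2) (Fin 2) ℂ) (v : Spinor) : actL M v = act M v := rfl

theorem ae_fst_ne_zero : ∀ᵐ p : ℝ × ℝ, p.1 ≠ 0 := by
  have h : ∀ᵐ x : ℝ, x ≠ 0 := by
    rw [ae_iff]; simp
  exact (Measure.quasiMeasurePreserving_fst (μ := (volume : Measure ℝ))
    (ν := (volume : Measure ℝ))).ae h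

variable {G H : ℝ × ℝ → Spinor}

theorem Admissible.ae_integrable (hG : Admissible G) :
    ∀ᵐ x : ℝ, Integrable (fun k => G (x, k)) := by
  have h : ∀ᵐ x : ℝ, x ≠ 0 := by
    rw [ae_iff]; simp
  exact h.mono hG.2

theorem Admissible.add (hG : Admissible G) (hH : Admissible H) :
    Admissible (fun p => G p + H p) :=
  ⟨hG.1.add hH.1, fun x hx => (hG.2 x hx).add (hH.2 x hx)⟩

theorem Admissible.const_smul (hG : Admissible G) (c : ℂ) : Admissible (fun p => c • G p) :=
  ⟨hG.1.const_smul c, fun x hx => (hG.2 x hx).smul c⟩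

theorem Admissible.act (hG : Admissible G) (M : Matrix (Fin 2) (Fin 2) ℂ) :
    Admissible (fun p => act M (G p)) :=
  ⟨(actL M).comp_memLp' hG.1, fun x hx => (actL M).integrable_comp (hG.2 x hx)⟩

theorem Admissible.memLp_partialFourier (hG : Admissible G) :
    MemLp (partialFourier G) 2 volume :=
  DiracLine.memLp_partialFourier hG.1 hG.ae_integrable

/-- Plancherel's identity in the second variable. -/
theorem Admissible.l2Inner_partialFourier (hG : Admissible G) (hH : Admissible H) :
    l2Inner (partialFourier G) (partialFourier H)
      = (2 * Real.pi : ℝ) * ∫ p, inner ℂ (G p) (H p) :=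
  integral_inner_partialFourier hG.1 hG.ae_integrable hH.1 hH.ae_integrable

theorem partialFourier_add (hG : Admissible G) (hH : Admissible H) {p : ℝ × ℝ} (hp : p.1 ≠ 0) :
    partialFourier (fun p => G p + H p) p = partialFourier G p + partialFourier H p := by
  simp only [partialFourier, fourierExp, smul_add]
  exact integral_add (integrable_exp_smul (hG.2 _ hp) _) (integrable_exp_smul (hH.2 _ hp) _)

theorem partialFourier_smul (G : ℝ × ℝ → Spinor) (c : ℝ → ℂ) (p : ℝ × ℝ) :
    partialFourier (fun p => c p.1 • G p) p = c p.1 • partialFourier G p := by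
  simp only [partialFourier, fourierExp]
  rw [← integral_smul]
  congr 1; funext k
  rw [smul_comm]

theorem partialFourier_act (hG : Admissible G) (M : Matrix (Fin 2) (Fin 2) ℂ) {p : ℝ × ℝ}
    (hp : p.1 ≠ 0) : partialFourier (fun p => act M (G p)) p = act M (partialFourier G p) := by
  simp only [partialFourier, fourierExp, ← actL_apply]
  rw [← ContinuousLinearMap.integral_comp_comm _ (integrable_exp_smul (hG.2 _ hp) _)]
  simp only [map_smul]

theorem fourierExp_apply {f : ℝ → Spinor} (hf : Integrable f) (y : ℝ) (i : Fin 2) :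
    fourierExp f y i = fourierExp (fun k => f k i) y := by
  simp only [fourierExp]
  exact ((EuclideanSpace.proj (𝕜 := ℂ) i).integral_comp_comm
    (integrable_exp_smul hf y)).symm

end Admissible

section Eigenfunction

variable {m η τ : ℝ}

theorem abs_logDerivAdd_le (hm : 0 < m) (hη : η ≠ 0) (x k : ℝ) :
    |logDerivAdd m η x k| ≤ 1 / (2 * freq m η 0) + |x| :=
  abs_logDeriv_le hm hη (by simp) x k

theorem abs_logDerivSub_le (hm : 0 < m) (hη : η ≠ 0) (x k : ℝ) :
    |logDerivSub m η x k| ≤ 1 / (2 * freq m η 0) + |x| :=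
  abs_logDeriv_le hm hη (by simp) x k

theorem inv_sqrt_sq_le (hm : 0 < m) (hη : η ≠ 0) (k : ℝ) :
    (1 / √(k ^ 2 + 4 * m ^ 2 / η ^ 2)) ^ 2 ≤ (1 / freq m η 0) ^ 2 := by
  have h0 := freq_pos hm hη 0
  have := le_freq m η k
  rw [show √(k ^ 2 + 4 * m ^ 2 / η ^ 2) = freq m η k from rfl]
  have hk := freq_pos hm hη k
  gcongr

theorem integrable_norm_sq_mul {f : ℝ → ℂ} (hf : MemLp f 2 volume) {W : ℝ → ℝ} {C : ℝ}
    (hW : Measurable W) (h0 : ∀ k, 0 ≤ W k) (hC : ∀ k, W k ≤ C) :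
    Integrable (fun k => ‖f k‖ ^ 2 * W k) :=
  ((memLp_two_iff_integrable_sq_norm hf.1).1 hf).mul_bdd (c := C) hW.aestronglyMeasurable
    (Filter.Eventually.of_forall fun k => by rw [Real.norm_of_nonneg (h0 k)]; exact hC k)

theorem admissible_amplitude (hm : 0 < m) (h : η ^ 2 - τ ^ 2 = 4) {f : ℝ → ℂ}
    (hf : MemLp f 2 volume) : Admissible (fun p => f p.2 • amplitude m η τ 1 1 p) := by
  refine ⟨?_, fun x hx => integrable_smul_amplitude hm h hx measurable_const measurable_const
    (C := 1) (by simp) (by simp) hf⟩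
  rw [memLp_smul_iff (stronglyMeasurable_amplitude measurable_const measurable_const) hf.1
    fun k => (integral_norm_sq_amplitude hm h k).1]
  simp only [(integral_norm_sq_amplitude hm h _).2]
  exact ((memLp_two_iff_integrable_sq_norm hf.1).1 hf).mul_const _

theorem admissible_amplitudeDeriv (hm : 0 < m) (h : η ^ 2 - τ ^ 2 = 4) {f : ℝ → ℂ}
    (hf : MemLp f 2 volume) : Admissible (fun p => f p.2 • amplitudeDeriv m η τ p) := by
  have hη := ne_zero_of_sq_sub_sq h
  have hx (x : ℝ) : Measurable (fun k : ℝ => (x, k)) := by fun_prop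
  refine ⟨?_, fun x hx0 => integrable_smul_amplitude hm h hx0
    ((measurable_logDerivAdd m η).comp (hx x)) ((measurable_logDerivSub m η).comp (hx x))
    (abs_logDerivAdd_le hm hη x) (abs_logDerivSub_le hm hη x) hf⟩
  have hsm : StronglyMeasurable (amplitudeDeriv m η τ) :=
    stronglyMeasurable_amplitude (measurable_logDerivAdd m η) (measurable_logDerivSub m η)
  rw [memLp_smul_iff hsm hf.1 fun k => (integral_norm_sq_amplitudeDeriv hm h k).1]
  simp only [(integral_norm_sq_amplitudeDeriv hm h _).2]
  refine integrable_norm_sq_mul hf (by fun_prop) (fun k => by positivity)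
    (C := 1 / (2 * Real.pi) * (1 / 4 * (1 / freq m η 0) ^ 2)) fun k => ?_
  have := inv_sqrt_sq_le hm hη k
  gcongr

theorem admissible_fst_smul_amplitude (hm : 0 < m) (h : η ^ 2 - τ ^ 2 = 4) {f : ℝ → ℂ}
    (hf : MemLp f 2 volume) :
    Admissible (fun p => f p.2 • (p.1 : ℂ) • amplitude m η τ 1 1 p) := by
  have hη := ne_zero_of_sq_sub_sq h
  have hsm : StronglyMeasurable (fun p : ℝ × ℝ => (p.1 : ℂ) • amplitude m η τ 1 1 p) :=
    (Complex.continuous_ofReal.comp continuous_fst).stronglyMeasurable.smul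
      (stronglyMeasurable_amplitude measurable_const measurable_const)
  refine ⟨?_, fun x hx => ?_⟩
  · rw [memLp_smul_iff hsm hf.1 fun k => (integral_norm_sq_smul_amplitude hm h k).1]
    simp only [(integral_norm_sq_smul_amplitude hm h _).2]
    refine integrable_norm_sq_mul hf (by fun_prop) (fun k => by positivity)
      (C := 1 / (2 * Real.pi) * (1 / 2 * (1 / freq m η 0) ^ 2)) fun k => ?_
    have := inv_sqrt_sq_le hm hη k
    gcongr
  · refine (((admissible_amplitude hm h hf).2 x hx).smul (x : ℂ)).congr
      (Filter.Eventually.of_forall fun k => ?_)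
    simp only [Pi.smul_apply]
    rw [smul_comm]

theorem transmission_eq (h : η ^ 2 - τ ^ 2 = 4) :
    transmission η τ = !![0, -I * ((η - τ) / 2); -I * ((η + τ) / 2), 0] := by
  have hc : (η : ℂ) ^ 2 - (τ : ℂ) ^ 2 = 4 := by exact_mod_cast h
  have hinv : (I • σ₁ - (1 / 2 : ℂ) • ((η : ℂ) • σ₀ + (τ : ℂ) • σ₃))⁻¹
      = (1 / 2 : ℂ) • !![-((η - τ) / 2 : ℂ), -I; -I, -((η + τ) / 2 : ℂ)] := by
    refine Matrix.inv_eq_left_inv ?_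
    ext i j
    fin_cases i <;> fin_cases j <;>
      simp [σ₀, σ₁, σ₃, Matrix.mul_apply, Fin.sum_univ_two]
    all_goals first | ring1 | linear_combination (1 / 8 : ℂ) * hc - (1 / 2) * Complex.I_sq
  rw [transmission, hinv]
  ext i j
  fin_cases i <;> fin_cases j <;>
    simp [σ₀, σ₁, σ₃, Matrix.mul_apply, Fin.sum_univ_two]
  all_goals first | linear_combination (-1 / 8 : ℂ) * hc - (1 / 2) * Complex.I_sq | ring

theorem half_sub_mul_sqrt (h : η ^ 2 - τ ^ 2 = 4) (r : ℝ) :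
    (η - τ) / 2 * √((1 + τ / η) * r) = η / |η| * √((1 - τ / η) * r) := by
  have hη := ne_zero_of_sq_sub_sq h
  have hb : (η - τ) / 2 = η / |η| * |(η - τ) / 2| := by
    have e : (η - τ) / 2 = η * ((1 - τ / η) / 2) := by field_simp
    rw [e, abs_mul, abs_of_pos (half_pos (one_sub_ratio_pos h))]
    have : |η| ≠ 0 := abs_ne_zero.2 hη
    field_simp
  rw [hb, mul_assoc]
  congr 1
  rw [← Real.sqrt_sq_eq_abs, ← Real.sqrt_mul (sq_nonneg _)]
  congr 1
  field_simp
  linear_combination (η - τ) * r * h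

theorem half_add_mul_sqrt (h : η ^ 2 - τ ^ 2 = 4) (r : ℝ) :
    (η + τ) / 2 * √((1 - τ / η) * r) = η / |η| * √((1 + τ / η) * r) := by
  have := half_sub_mul_sqrt (η := η) (τ := -τ) (by linarith) r
  simpa [neg_div, ← sub_eq_add_neg] using this

theorem amplitude_eq_act (h : η ^ 2 - τ ^ 2 = 4) {x : ℝ} (hx : x ≠ 0) (k : ℝ) :
    amplitude m η τ 1 1 (x, k) = ((1 / (2 * √Real.pi) : ℝ) : ℂ) •
      act (heaviside x • transmission η τ + heaviside (-x) • σ₀)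
        (cexp (-((freq m η k * |x| : ℝ) : ℂ)) • momentumSpinor m η τ k) := by
  have e : cexp (-((freq m η k * |x| : ℝ) : ℂ)) = (Real.exp (-(freq m η k * |x|)) : ℂ) := by
    push_cast; rfl
  rw [e]
  rcases lt_or_gt_of_ne hx with hx | hx
  · have e1 : heaviside x = 0 := if_neg hx.not_gt
    have e2 : heaviside (-x) = 1 := if_pos (neg_pos.2 hx)
    ext i
    fin_cases i <;>
      simp [amplitude, upper, lower, act, momentumSpinor, e1, e2, σ₀, hx.not_gt] <;> ring
  · have e1 : heaviside x = 1 := if_pos hx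
    have e2 : heaviside (-x) = 0 := if_neg (neg_pos.not.2 hx.not_gt)
    have h1 := congrArg ((↑) : ℝ → ℂ) (half_sub_mul_sqrt h (freq m η k - k))
    have h2 := congrArg ((↑) : ℝ → ℂ) (half_add_mul_sqrt h (freq m η k + k))
    push_cast at h1 h2
    ext i
    fin_cases i
    · simp [amplitude, upper, act, momentumSpinor, e1, e2, hx, transmission_eq h]
      linear_combination ((↑√Real.pi : ℂ)⁻¹ * 2⁻¹ * cexp (-(↑(freq m η k) * ↑|x|))) * (h1
        - (↑η - ↑τ) / 2 * ↑√((1 + τ / η) * (freq m η k - k)) * Complex.I_sq)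
    · simp [amplitude, lower, act, momentumSpinor, e1, e2, hx, transmission_eq h]
      linear_combination (-I) * ((↑√Real.pi : ℂ)⁻¹ * 2⁻¹ * cexp (-(↑(freq m η k) * ↑|x|))) * h2

theorem eigenfunction_eq_partialFourier (hm : 0 < m) (h : η ^ 2 - τ ^ 2 = 4) {Ξ : ℝ → ℂ}
    (hΞ : MemLp Ξ 2 volume) {p : ℝ × ℝ} (hp : p.1 ≠ 0) :
    eigenfunction m η τ Ξ p = partialFourier (fun p => Ξ p.2 • amplitude m η τ 1 1 p) p := by
  obtain ⟨x, y⟩ := p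
  have hp' : x ≠ 0 := hp
  have hneg : ∀ k, cexp (-((freq m η k * |x| : ℝ) : ℂ)) • momentumSpinor m η τ k
      = ((2 * √Real.pi : ℝ) : ℂ) • amplitude m η τ 1 1 (-|x|, k) := fun k => by
    have hx := abs_pos.2 hp'
    rw [amplitude_eq_act h (neg_ne_zero.2 hx.ne'), smul_smul]
    have e1 : heaviside (-|x|) = 0 := if_neg (by linarith)
    have e2 : heaviside (- -|x|) = 1 := if_pos (by linarith)
    have e3 : ((2 * √Real.pi : ℝ) : ℂ) * ((1 / (2 * √Real.pi) : ℝ) : ℂ) = 1 := by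
      rw [← Complex.ofReal_mul, mul_one_div_cancel (by positivity), Complex.ofReal_one]
    rw [e1, e2, e3, one_smul, zero_smul, zero_add, one_smul, σ₀, abs_neg, abs_abs]
    simp [act]
  have hint : Integrable (fun k => Ξ k • (cexp (-((freq m η k * |x| : ℝ) : ℂ)) •
      momentumSpinor m η τ k)) := by
    simp only [hneg]
    refine (((admissible_amplitude hm h hΞ).2 (-|x|) (by simpa using hp')).smul
      ((2 * √Real.pi : ℝ) : ℂ)).congr (Filter.Eventually.of_forall fun k => ?_)
    simp only [Pi.smul_apply]
    rw [smul_comm]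
  have e : ∀ k : ℝ, (Ξ k * cexp (I * k * y - ((freq m η k * |x| : ℝ) : ℂ))) •
      momentumSpinor m η τ k = cexp (I * k * y) • (Ξ k •
        (cexp (-((freq m η k * |x| : ℝ) : ℂ)) • momentumSpinor m η τ k)) := fun k => by
    rw [sub_eq_add_neg, Complex.exp_add, smul_smul, smul_smul]
    congr 1; ring
  simp only [eigenfunction, partialFourier, fourierExp, e]
  rw [← actL_apply, ← ContinuousLinearMap.integral_comp_comm _ (integrable_exp_smul hint y),
    ← integral_smul]
  congr 1; funext k
  rw [map_smul, map_smul, amplitude_eq_act h hp', smul_comm, smul_comm _ (Ξ k), actL_apply]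

/-- Multiplication of `ψ_Ξ` by `y`, in terms of the weak derivative of `Ξ`. -/
theorem snd_smul_partialFourier (hm : 0 < m) (h : η ^ 2 - τ ^ 2 = 4) {f f' : ℝ → ℂ}
    (hw : HasWeakDeriv f f') (hf : MemLp f 2 volume) (hf' : MemLp f' 2 volume) {p : ℝ × ℝ}
    (hp : p.1 ≠ 0) :
    (p.2 : ℂ) • partialFourier (fun p => f p.2 • amplitude m η τ 1 1 p) p
      = partialFourier (fun p => I • (f' p.2 • amplitude m η τ 1 1 p
          + f p.2 • amplitudeDeriv m η τ p)) p := by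
  obtain ⟨x, y⟩ := p
  have h0 := (admissible_amplitude hm h hf).2 x hp
  have h1 : Integrable (fun k => f' k • amplitude m η τ 1 1 (x, k)
      + f k • amplitudeDeriv m η τ (x, k)) :=
    ((admissible_amplitude hm h hf').add (admissible_amplitudeDeriv hm h hf)).2 x hp
  have h2 : Integrable (fun k => I • (f' k • amplitude m η τ 1 1 (x, k)
      + f k • amplitudeDeriv m η τ (x, k))) := h1.smul I
  simp only [partialFourier]
  ext i
  rw [PiLp.smul_apply, fourierExp_apply h0, fourierExp_apply h2]
  have c0 := (EuclideanSpace.proj (𝕜 := ℂ) i).integrable_comp h0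
  have c1 := (EuclideanSpace.proj (𝕜 := ℂ) i).integrable_comp h1
  fin_cases i
  · exact (hw.fourierExp_eq (Complex.ofRealCLM.contDiff.comp (contDiff_upper hm h x))
      (fun k => (hasDerivAt_upper hm h x k).ofReal_comp) c0 c1 y).symm
  · exact (hw.fourierExp_eq
      (contDiff_const.mul (Complex.ofRealCLM.contDiff.comp (contDiff_lower hm h x)))
      (fun k => ((hasDerivAt_lower hm h x k).ofReal_comp).const_mul (-I)) c0 c1 y).symm

end Eigenfunction

section SquareIntegrable

variable {α E : Type*} [MeasureSpace α] [NormedAddCommGroup E] [InnerProductSpace ℂ E]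

theorem l2Inner_congr {f f' g g' : α → E} (hf : f =ᵐ[volume] f') (hg : g =ᵐ[volume] g') :
    l2Inner f g = l2Inner f' g' := by
  refine integral_congr_ae ?_
  filter_upwards [hf, hg] with a h1 h2
  rw [h1, h2]

theorem l2Norm_sq {f : α → E} (hf : MemLp f 2 volume) : (l2Norm f : ℂ) ^ 2 = l2Inner f f := by
  have h := inner_self_eq_norm_sq_to_K (𝕜 := ℂ) (hf.toLp f)
  rw [L2.inner_def, Lp.norm_toLp] at h
  refine h.symm.trans (integral_congr_ae ?_)
  filter_upwards [hf.coeFn_toLp] with a ha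
  rw [ha]

end SquareIntegrable

section Moments

variable {m η τ : ℝ} {f g : ℝ → ℂ}

theorem inner_mul_real (z : ℂ) (c : ℝ) : inner ℂ ((c : ℂ) * z) ((c : ℂ) * z)
    = inner ℂ z z * ((c ^ 2 : ℝ) : ℂ) := by
  simp only [RCLike.inner_apply, map_mul, Complex.conj_ofReal]
  push_cast; ring

theorem memLp_inv_sqrt_mul (hm : 0 < m) (hη : η ≠ 0) (hf : MemLp f 2 volume) :
    MemLp (fun k => ((1 / √(k ^ 2 + 4 * m ^ 2 / η ^ 2) : ℝ) : ℂ) * f k) 2 volume := by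
  have hmeas : Measurable (fun k : ℝ => 1 / √(k ^ 2 + 4 * m ^ 2 / η ^ 2)) := by fun_prop
  have hm1 : AEStronglyMeasurable
      (fun k => ((1 / √(k ^ 2 + 4 * m ^ 2 / η ^ 2) : ℝ) : ℂ) * f k) :=
    (Complex.measurable_ofReal.comp hmeas).aestronglyMeasurable.mul hf.1
  rw [memLp_two_iff_integrable_sq_norm hm1]
  refine (integrable_norm_sq_mul hf (hmeas.pow_const 2) (fun k => by positivity)
    (inv_sqrt_sq_le hm hη)).congr (Filter.Eventually.of_forall fun k => ?_)
  simp only [norm_mul, mul_pow, Complex.norm_real, Real.norm_eq_abs, sq_abs]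
  ring

theorem two_pi_mul_integral {P Q : ℝ × ℝ → Spinor}
    (hP : MemLp (fun p => f p.2 • P p) 2 volume) (hQ : MemLp (fun p => g p.2 • Q p) 2 volume)
    {W : ℝ → ℂ} (hW : ∀ k, ∫ x, inner ℂ (P (x, k)) (Q (x, k)) = 1 / (2 * Real.pi : ℝ) * W k) :
    ((2 * Real.pi : ℝ) : ℂ) * ∫ p : ℝ × ℝ, inner ℂ (f p.2 • P p) (g p.2 • Q p)
      = ∫ k, inner ℂ (f k) (g k) * W k := by
  have hpi : ((2 * Real.pi : ℝ) : ℂ) ≠ 0 := by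
    exact_mod_cast (by positivity : (2 * Real.pi : ℝ) ≠ 0)
  rw [integral_inner_smul hP hQ, ← integral_const_mul]
  congr 1; funext k
  rw [hW]
  field_simp

theorem integral_inner_self_amplitude (hm : 0 < m) (h : η ^ 2 - τ ^ 2 = 4) (k : ℝ) :
    ∫ x, inner ℂ (amplitude m η τ 1 1 (x, k)) (amplitude m η τ 1 1 (x, k))
      = 1 / (2 * Real.pi : ℝ) * 1 := by
  rw [integral_inner_self_re, (integral_norm_sq_amplitude hm h k).2]
  push_cast; ring

theorem integral_inner_self_amplitudeDeriv (hm : 0 < m) (h : η ^ 2 - τ ^ 2 = 4) (k : ℝ) :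
    ∫ x, inner ℂ (amplitudeDeriv m η τ (x, k)) (amplitudeDeriv m η τ (x, k))
      = 1 / (2 * Real.pi : ℝ) *
        (1 / 4 * (((1 / √(k ^ 2 + 4 * m ^ 2 / η ^ 2)) ^ 2 : ℝ) : ℂ)) := by
  rw [integral_inner_self_re, (integral_norm_sq_amplitudeDeriv hm h k).2]
  push_cast; ring

theorem integral_inner_self_smul_amplitude (hm : 0 < m) (h : η ^ 2 - τ ^ 2 = 4) (k : ℝ) :
    ∫ x : ℝ, inner ℂ ((x : ℂ) • amplitude m η τ 1 1 (x, k)) ((x : ℂ) • amplitude m η τ 1 1 (x, k))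
      = 1 / (2 * Real.pi : ℝ) *
        (1 / 2 * (((1 / √(k ^ 2 + 4 * m ^ 2 / η ^ 2)) ^ 2 : ℝ) : ℂ)) := by
  rw [integral_inner_self_re, (integral_norm_sq_smul_amplitude hm h k).2]
  push_cast; ring

/-- The pairing of `f A` with the `k`-derivative `g A + h ∂ₖA`. -/
theorem two_pi_mul_integral_inner_deriv (hm : 0 < m) (h : η ^ 2 - τ ^ 2 = 4)
    (hf : MemLp f 2 volume) {g g' : ℝ → ℂ} (hg : MemLp g 2 volume) (hg' : MemLp g' 2 volume) :
    ((2 * Real.pi : ℝ) : ℂ) * ∫ p : ℝ × ℝ, inner ℂ (f p.2 • amplitude m η τ 1 1 p)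
        (I • (g' p.2 • amplitude m η τ 1 1 p + g p.2 • amplitudeDeriv m η τ p))
      = I * ∫ k, inner ℂ (f k) (g' k) := by
  have a0 := (admissible_amplitude hm h hf).1
  have a1 := (admissible_amplitude hm h hg').1
  have a2 := (admissible_amplitudeDeriv hm h hg).1
  have e : ∀ p : ℝ × ℝ, inner ℂ (f p.2 • amplitude m η τ 1 1 p)
        (I • (g' p.2 • amplitude m η τ 1 1 p + g p.2 • amplitudeDeriv m η τ p))
      = I * (inner ℂ (f p.2 • amplitude m η τ 1 1 p) (g' p.2 • amplitude m η τ 1 1 p)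
        + inner ℂ (f p.2 • amplitude m η τ 1 1 p) (g p.2 • amplitudeDeriv m η τ p)) :=
    fun p => by rw [inner_smul_right, inner_add_right]
  simp only [e]
  rw [integral_const_mul, integral_add (integrable_inner_of_memLp a0 a1)
    (integrable_inner_of_memLp a0 a2), mul_left_comm, mul_add,
    two_pi_mul_integral a0 a1 (integral_inner_self_amplitude hm h),
    two_pi_mul_integral a0 a2 (W := 0) fun k => by
      rw [integral_inner_amplitude_amplitudeDeriv hm h]; simp]
  simp

theorem two_pi_mul_integral_inner_deriv_self (hm : 0 < m) (h : η ^ 2 - τ ^ 2 = 4)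
    {g g' : ℝ → ℂ} (hg : MemLp g 2 volume) (hg' : MemLp g' 2 volume) :
    ((2 * Real.pi : ℝ) : ℂ) * ∫ p : ℝ × ℝ,
        inner ℂ (I • (g' p.2 • amplitude m η τ 1 1 p + g p.2 • amplitudeDeriv m η τ p))
        (I • (g' p.2 • amplitude m η τ 1 1 p + g p.2 • amplitudeDeriv m η τ p))
      = l2Inner g' g' + 1 / 4 * (l2Norm
          (fun k => ((1 / √(k ^ 2 + 4 * m ^ 2 / η ^ 2) : ℝ) : ℂ) * g k) : ℂ) ^ 2 := by
  have a1 := (admissible_amplitude hm h hg').1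
  have a2 := (admissible_amplitudeDeriv hm h hg).1
  have e : ∀ p : ℝ × ℝ,
      inner ℂ (I • (g' p.2 • amplitude m η τ 1 1 p + g p.2 • amplitudeDeriv m η τ p))
        (I • (g' p.2 • amplitude m η τ 1 1 p + g p.2 • amplitudeDeriv m η τ p))
      = (inner ℂ (g' p.2 • amplitude m η τ 1 1 p) (g' p.2 • amplitude m η τ 1 1 p)
          + inner ℂ (g' p.2 • amplitude m η τ 1 1 p) (g p.2 • amplitudeDeriv m η τ p))
        + (inner ℂ (g p.2 • amplitudeDeriv m η τ p) (g' p.2 • amplitude m η τ 1 1 p)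
          + inner ℂ (g p.2 • amplitudeDeriv m η τ p) (g p.2 • amplitudeDeriv m η τ p)) :=
    fun p => by
      rw [inner_smul_left, inner_smul_right, ← mul_assoc, Complex.conj_I, neg_mul,
        Complex.I_mul_I, neg_neg, one_mul, inner_add_left, inner_add_right, inner_add_right]
  simp only [e]
  have i11 := integrable_inner_of_memLp a1 a1
  have i12 := integrable_inner_of_memLp a1 a2
  have i21 := integrable_inner_of_memLp a2 a1
  have i22 := integrable_inner_of_memLp a2 a2
  have i1 : Integrable (fun p : ℝ × ℝ =>
      (inner ℂ (g' p.2 • amplitude m η τ 1 1 p) (g' p.2 • amplitude m η τ 1 1 p)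
          + inner ℂ (g' p.2 • amplitude m η τ 1 1 p) (g p.2 • amplitudeDeriv m η τ p))) :=
    i11.add i12
  have i2 : Integrable (fun p : ℝ × ℝ =>
      (inner ℂ (g p.2 • amplitudeDeriv m η τ p) (g' p.2 • amplitude m η τ 1 1 p)
          + inner ℂ (g p.2 • amplitudeDeriv m η τ p) (g p.2 • amplitudeDeriv m η τ p))) :=
    i21.add i22
  rw [integral_add i1 i2, integral_add i11 i12, integral_add i21 i22, mul_add, mul_add, mul_add,
    two_pi_mul_integral a1 a1 (integral_inner_self_amplitude hm h),
    two_pi_mul_integral a1 a2 (W := 0) fun k => by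
      rw [integral_inner_amplitude_amplitudeDeriv hm h]; simp,
    two_pi_mul_integral a2 a1 (W := 0) fun k => by
      rw [integral_inner_amplitudeDeriv_amplitude hm h]; simp,
    two_pi_mul_integral a2 a2 (integral_inner_self_amplitudeDeriv hm h),
    l2Norm_sq (memLp_inv_sqrt_mul hm (ne_zero_of_sq_sub_sq h) hg), l2Inner, l2Inner,
    ← integral_const_mul]
  simp only [inner_mul_real, Pi.zero_apply, mul_zero, integral_zero, add_zero, zero_add, mul_one,
    mul_left_comm (1 / 4 : ℂ)]

end Moments

section Isometry

variable {m η τ : ℝ}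

theorem partialFourier_congr {f g : ℝ → ℂ} (h : f =ᵐ[volume] g) (P : ℝ × ℝ → Spinor) :
    partialFourier (fun p => f p.2 • P p) = partialFourier (fun p => g p.2 • P p) := by
  funext p
  refine integral_congr_ae ?_
  filter_upwards [h] with k hk
  simp only [hk]

theorem l2Norm_sq_partialFourier_amplitude (hm : 0 < m) (h : η ^ 2 - τ ^ 2 = 4) {f : ℝ → ℂ}
    (hf : MemLp f 2 volume) :
    (l2Norm (partialFourier (fun p => f p.2 • amplitude m η τ 1 1 p)) : ℂ) ^ 2
      = (l2Norm f : ℂ) ^ 2 := by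
  have a := admissible_amplitude hm h hf
  rw [l2Norm_sq a.memLp_partialFourier, l2Norm_sq hf, a.l2Inner_partialFourier a,
    two_pi_mul_integral a.1 a.1 (integral_inner_self_amplitude hm h)]
  simp only [mul_one, l2Inner]

/-- The isometry `Ξ ↦ ψ_Ξ`. -/
def eigenIsometry (hm : 0 < m) (h : η ^ 2 - τ ^ 2 = 4) :
    Lp ℂ 2 (volume : Measure ℝ) →ₗᵢ[ℂ] Lp Spinor 2 (volume : Measure (ℝ × ℝ)) where
  toFun ξ := (admissible_amplitude hm h (Lp.memLp ξ)).memLp_partialFourier.toLp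
  map_add' ξ ζ := by
    have a := admissible_amplitude hm h (Lp.memLp ξ)
    have b := admissible_amplitude hm h (Lp.memLp ζ)
    rw [← MemLp.toLp_add]
    refine MemLp.toLp_congr _ _ ?_
    rw [partialFourier_congr (Lp.coeFn_add ξ ζ)]
    filter_upwards [ae_fst_ne_zero] with p hp
    simp only [Pi.add_apply, add_smul]
    exact partialFourier_add a b hp
  map_smul' c ξ := by
    rw [RingHom.id_apply, ← MemLp.toLp_const_smul]
    refine MemLp.toLp_congr _ _ ?_
    rw [partialFourier_congr (Lp.coeFn_smul c ξ)]
    filter_upwards with p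
    simp only [Pi.smul_apply, smul_assoc]
    exact partialFourier_smul _ (fun _ => c) p
  norm_map' ξ := by
    have e := l2Norm_sq_partialFourier_amplitude hm h (Lp.memLp ξ)
    have e' : l2Norm (partialFourier (fun p => ξ p.2 • amplitude m η τ 1 1 p)) ^ 2
        = l2Norm ξ ^ 2 := by exact_mod_cast e
    simp only [LinearMap.coe_mk, AddHom.coe_mk, Lp.norm_toLp]
    exact (sq_eq_sq₀ ENNReal.toReal_nonneg ENNReal.toReal_nonneg).1 e'

theorem inner_eigenIsometry (hm : 0 < m) (h : η ^ 2 - τ ^ 2 = 4) {Y : ℝ × ℝ → Spinor}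
    (hY : MemLp Y 2 volume) {f : ℝ → ℂ} (hf : MemLp f 2 volume) :
    inner ℂ (hY.toLp Y) (eigenIsometry hm h (hf.toLp f))
      = l2Inner Y (partialFourier (fun p => f p.2 • amplitude m η τ 1 1 p)) := by
  have a := (admissible_amplitude hm h (Lp.memLp (hf.toLp f))).memLp_partialFourier
  rw [L2.inner_def]
  refine integral_congr_ae ?_
  filter_upwards [hY.coeFn_toLp, a.coeFn_toLp] with p h1 h2
  rw [h1]
  congr 1
  exact h2.trans (by rw [partialFourier_congr hf.coeFn_toLp])

end Isometry

section Domain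

variable {m η τ : ℝ} {Ξ : ℝ → ℂ}

theorem eigenfunction_ae_eq (hm : 0 < m) (h : η ^ 2 - τ ^ 2 = 4) (hΞ : MemLp Ξ 2 volume) :
    eigenfunction m η τ Ξ =ᵐ[volume] partialFourier (fun p => Ξ p.2 • amplitude m η τ 1 1 p) := by
  filter_upwards [ae_fst_ne_zero] with p hp
  exact eigenfunction_eq_partialFourier hm h hΞ hp

theorem memLp_eigenfunction (hm : 0 < m) (h : η ^ 2 - τ ^ 2 = 4) (hΞ : MemLp Ξ 2 volume) :
    MemLp (eigenfunction m η τ Ξ) 2 volume :=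
  (admissible_amplitude hm h hΞ).memLp_partialFourier.ae_eq (eigenfunction_ae_eq hm h hΞ).symm

theorem posX_ae_eq (hm : 0 < m) (h : η ^ 2 - τ ^ 2 = 4) (hΞ : MemLp Ξ 2 volume) :
    posX (eigenfunction m η τ Ξ) =ᵐ[volume]
      partialFourier (fun p => Ξ p.2 • (p.1 : ℂ) • amplitude m η τ 1 1 p) := by
  filter_upwards [eigenfunction_ae_eq hm h hΞ] with p hp
  simp only [posX, hp, smul_comm (Ξ _)]
  exact (partialFourier_smul _ (fun x => (x : ℂ)) p).symm

theorem posY_ae_eq (hm : 0 < m) (h : η ^ 2 - τ ^ 2 = 4) (hΞ : MemLp Ξ 2 volume) {Ξ' : ℝ → ℂ}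
    (hw : HasWeakDeriv Ξ Ξ') (hΞ' : MemLp Ξ' 2 volume) :
    posY (eigenfunction m η τ Ξ) =ᵐ[volume]
      partialFourier (fun p => I • (Ξ' p.2 • amplitude m η τ 1 1 p
          + Ξ p.2 • amplitudeDeriv m η τ p)) := by
  filter_upwards [eigenfunction_ae_eq hm h hΞ, ae_fst_ne_zero] with p hp hp0
  simp only [posY, hp]
  exact snd_smul_partialFourier hm h hw hΞ hΞ' hp0

theorem act_ae_eq (hm : 0 < m) (h : η ^ 2 - τ ^ 2 = 4) (hΞ : MemLp Ξ 2 volume)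
    (M : Matrix (Fin 2) (Fin 2) ℂ) :
    (fun p => act M (eigenfunction m η τ Ξ p)) =ᵐ[volume]
      partialFourier (fun p => Ξ p.2 • act M (amplitude m η τ 1 1 p)) := by
  filter_upwards [eigenfunction_ae_eq hm h hΞ, ae_fst_ne_zero] with p hp hp0
  simp only [hp, ← act_smul]
  exact (partialFourier_act (admissible_amplitude hm h hΞ) M hp0).symm

theorem inDomain_posX (hm : 0 < m) (h : η ^ 2 - τ ^ 2 = 4) (hΞ : MemLp Ξ 2 volume) :
    InDomain posX (eigenfunction m η τ Ξ) :=
  ⟨memLp_eigenfunction hm h hΞ, (admissible_fst_smul_amplitude hm h hΞ).memLp_partialFourier.ae_eq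
    (posX_ae_eq hm h hΞ).symm⟩

theorem admissible_deriv (hm : 0 < m) (h : η ^ 2 - τ ^ 2 = 4) (hΞ : MemLp Ξ 2 volume)
    {Ξ' : ℝ → ℂ} (hΞ' : MemLp Ξ' 2 volume) :
    Admissible (fun p => I • (Ξ' p.2 • amplitude m η τ 1 1 p
          + Ξ p.2 • amplitudeDeriv m η τ p)) :=
  ((admissible_amplitude hm h hΞ').add (admissible_amplitudeDeriv hm h hΞ)).const_smul I

theorem memLp_posY (hm : 0 < m) (h : η ^ 2 - τ ^ 2 = 4) (hΞ : MemLp Ξ 2 volume)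
    {Ξ' : ℝ → ℂ} (hw : HasWeakDeriv Ξ Ξ') (hΞ' : MemLp Ξ' 2 volume) :
    MemLp (posY (eigenfunction m η τ Ξ)) 2 volume :=
  (admissible_deriv hm h hΞ hΞ').memLp_partialFourier.ae_eq (posY_ae_eq hm h hΞ hw hΞ').symm

/-- If `y ψ_Ξ` is square integrable then `Ξ` has a square integrable weak derivative. -/
theorem exists_weakDeriv_of_posY (hm : 0 < m) (h : η ^ 2 - τ ^ 2 = 4) (hΞ : MemLp Ξ 2 volume)
    (hY : MemLp (posY (eigenfunction m η τ Ξ)) 2 volume) :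
    ∃ Ξ' : ℝ → ℂ, HasWeakDeriv Ξ Ξ' ∧ MemLp Ξ' 2 volume := by
  set V := (eigenIsometry (m := m) hm h).toContinuousLinearMap with hV
  set H : Lp ℂ 2 (volume : Measure ℝ) := ContinuousLinearMap.adjoint V (hY.toLp _) with hH
  have key : ∀ φ : ℝ → ℂ, ContDiff ℝ ∞ φ → HasCompactSupport φ →
      ∫ k, inner ℂ (H k) (φ k) = I * ∫ k, inner ℂ (Ξ k) (deriv φ k) := by
    intro φ hφ hc
    have hφd : Continuous (deriv φ) := hφ.continuous_deriv (by simp)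
    have l0 : MemLp φ 2 volume := hφ.continuous.memLp_of_hasCompactSupport hc
    have l1 : MemLp (deriv φ) 2 volume := hφd.memLp_of_hasCompactSupport hc.deriv
    have e1 : ∫ k, inner ℂ (H k) (φ k) = inner ℂ H (l0.toLp φ) := by
      rw [L2.inner_def]
      refine integral_congr_ae ?_
      filter_upwards [l0.coeFn_toLp] with k hk
      rw [hk]
    have e2 : inner ℂ H (l0.toLp φ) = inner ℂ (hY.toLp _) (eigenIsometry hm h (l0.toLp φ)) :=
      ContinuousLinearMap.adjoint_inner_left V _ _
    rw [e1, e2, inner_eigenIsometry hm h hY l0, ← two_pi_mul_integral_inner_deriv hm h hΞ l0 l1]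
    have a0 := admissible_amplitude hm h hΞ
    rw [← a0.l2Inner_partialFourier (admissible_deriv hm h l0 l1)]
    refine integral_congr_ae ?_
    filter_upwards [eigenfunction_ae_eq hm h hΞ, ae_fst_ne_zero] with p hp hp0
    rw [← snd_smul_partialFourier hm h (hasWeakDeriv_of_contDiff hφ) l0 l1 hp0, ← hp]
    simp only [posY, inner_smul_left, inner_smul_right, Complex.conj_ofReal]
  refine ⟨fun k => -I * H k, ⟨hΞ.locallyIntegrable (by norm_num),
    ((Lp.memLp H).const_mul (-I)).locallyIntegrable (by norm_num), fun φ hφ hc => ?_⟩,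
    (Lp.memLp H).const_mul (-I)⟩
  have hd : ∀ k, deriv (fun k => (starRingEnd ℂ) (φ k)) k = (starRingEnd ℂ) (deriv φ k) :=
    fun k => (Complex.conjCLE.toContinuousLinearMap.hasFDerivAt.comp_hasDerivAt k
      (hφ.differentiable (by simp) k).hasDerivAt).deriv
  have hk := congrArg (starRingEnd ℂ) (key (fun k => (starRingEnd ℂ) (φ k))
    (Complex.conjCLE.contDiff.comp hφ) (hc.comp_left (map_zero _)))
  rw [map_mul, ← integral_conj, ← integral_conj, Complex.conj_I] at hk
  simp only [hd, RCLike.inner_apply, map_mul, Complex.conj_conj] at hk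
  have e3 : ∀ k, -I * H k * φ k = -I * (φ k * H k) := fun k => by ring
  simp only [e3, integral_const_mul]
  rw [hk]
  simp only [mul_comm (Ξ _)]
  linear_combination (∫ k, deriv φ k * Ξ k) * Complex.I_sq

end Domain

section Observables

variable {m η τ : ℝ} {Ξ : ℝ → ℂ}

theorem mean_eq (hm : 0 < m) (h : η ^ 2 - τ ^ 2 = 4) (hΞ : MemLp Ξ 2 volume) {O : Observable}
    {G : ℝ × ℝ → Spinor} (hG : Admissible G)
    (hO : O (eigenfunction m η τ Ξ) =ᵐ[volume] partialFourier G) :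
    mean O (eigenfunction m η τ Ξ)
      = (2 * Real.pi : ℝ) * ∫ p, inner ℂ (Ξ p.2 • amplitude m η τ 1 1 p) (G p) := by
  rw [mean, l2Inner_congr (eigenfunction_ae_eq hm h hΞ) hO]
  exact (admissible_amplitude hm h hΞ).l2Inner_partialFourier hG

theorem l2Norm_sq_eq {O : Observable} {G : ℝ × ℝ → Spinor} (hG : Admissible G)
    (hO : O (eigenfunction m η τ Ξ) =ᵐ[volume] partialFourier G) :
    (l2Norm (O (eigenfunction m η τ Ξ)) : ℂ) ^ 2
      = (2 * Real.pi : ℝ) * ∫ p, inner ℂ (G p) (G p) := by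
  rw [l2Norm_sq (hG.memLp_partialFourier.ae_eq hO.symm), l2Inner_congr hO hO,
    hG.l2Inner_partialFourier hG]

theorem admissible_act_amplitude (hm : 0 < m) (h : η ^ 2 - τ ^ 2 = 4) (hΞ : MemLp Ξ 2 volume)
    (M : Matrix (Fin 2) (Fin 2) ℂ) :
    Admissible (fun p => Ξ p.2 • act M (amplitude m η τ 1 1 p)) := by
  simp only [← act_smul]
  exact (admissible_amplitude hm h hΞ).act M

theorem mean_act (hm : 0 < m) (h : η ^ 2 - τ ^ 2 = 4) (hΞ : MemLp Ξ 2 volume)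
    (hn : l2Norm Ξ = 1) (M : Matrix (Fin 2) (Fin 2) ℂ) (c : ℂ)
    (hc : ∀ k, ∫ x : ℝ, inner ℂ (amplitude m η τ 1 1 (x, k)) (act M (amplitude m η τ 1 1 (x, k)))
      = 1 / (2 * Real.pi : ℝ) * c) :
    mean (fun ψ p => act M (ψ p)) (eigenfunction m η τ Ξ) = c := by
  have a := admissible_act_amplitude hm h hΞ M
  have e := l2Norm_sq hΞ
  rw [hn, l2Inner] at e
  rw [mean_eq hm h hΞ a (act_ae_eq hm h hΞ M),
    two_pi_mul_integral (admissible_amplitude hm h hΞ).1 a.1 hc, integral_mul_const, ← e]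
  simp

theorem l2Norm_eigenfunction (hm : 0 < m) (h : η ^ 2 - τ ^ 2 = 4) (hΞ : MemLp Ξ 2 volume)
    (hn : l2Norm Ξ = 1) : (l2Norm (eigenfunction m η τ Ξ) : ℂ) ^ 2 = 1 := by
  rw [l2Norm, eLpNorm_congr_ae (eigenfunction_ae_eq hm h hΞ)]
  exact (l2Norm_sq_partialFourier_amplitude hm h hΞ).trans (by rw [hn]; simp)

theorem l2Norm_act (hm : 0 < m) (h : η ^ 2 - τ ^ 2 = 4) (hΞ : MemLp Ξ 2 volume)
    (hn : l2Norm Ξ = 1) {M : Matrix (Fin 2) (Fin 2) ℂ} (hM : ∀ v, ‖act M v‖ = ‖v‖) :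
    (l2Norm (fun p => act M (eigenfunction m η τ Ξ p)) : ℂ) ^ 2 = 1 := by
  rw [← l2Norm_eigenfunction hm h hΞ hn, l2Norm, l2Norm,
    eLpNorm_congr_norm_ae (Filter.Eventually.of_forall fun p => hM (eigenfunction m η τ Ξ p))]

theorem norm_act_σ₁ (v : Spinor) : ‖act σ₁ v‖ = ‖v‖ := by
  simp [EuclideanSpace.norm_eq, act, σ₁, Fin.sum_univ_two, Matrix.vecHead, Matrix.vecTail]
  rw [add_comm]

theorem norm_act_σ₂ (v : Spinor) : ‖act σ₂ v‖ = ‖v‖ := by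
  simp [EuclideanSpace.norm_eq, act, σ₂, Fin.sum_univ_two, Matrix.vecHead, Matrix.vecTail]
  rw [add_comm]

theorem norm_act_σ₃ (v : Spinor) : ‖act σ₃ v‖ = ‖v‖ := by
  simp [EuclideanSpace.norm_eq, act, σ₃, Fin.sum_univ_two, Matrix.vecHead, Matrix.vecTail]

theorem mean_spin (hm : 0 < m) (h : η ^ 2 - τ ^ 2 = 4) (hΞ : MemLp Ξ 2 volume)
    (hn : l2Norm Ξ = 1) : mean spin (eigenfunction m η τ Ξ) = -((τ : ℂ) / η) :=
  mean_act hm h hΞ hn σ₃ _ (integral_inner_spin_amplitude hm h)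

theorem mean_velX (hm : 0 < m) (h : η ^ 2 - τ ^ 2 = 4) (hΞ : MemLp Ξ 2 volume)
    (hn : l2Norm Ξ = 1) : mean velX (eigenfunction m η τ Ξ) = 0 :=
  mean_act hm h hΞ hn σ₁ _ fun k => by simp [inner_velX_amplitude]

theorem mean_velY (hm : 0 < m) (h : η ^ 2 - τ ^ 2 = 4) (hΞ : MemLp Ξ 2 volume)
    (hn : l2Norm Ξ = 1) : mean velY (eigenfunction m η τ Ξ) = 0 :=
  mean_act hm h hΞ hn σ₂ _ fun k => by simp [integral_inner_velY_amplitude hm h]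

theorem mean_posX (hm : 0 < m) (h : η ^ 2 - τ ^ 2 = 4) (hΞ : MemLp Ξ 2 volume) :
    mean posX (eigenfunction m η τ Ξ) = (τ : ℂ) / (2 * η) *
      l2Inner Ξ (fun k => ((k / (k ^ 2 + 4 * m ^ 2 / η ^ 2) : ℝ) : ℂ) * Ξ k) := by
  have a := admissible_fst_smul_amplitude hm h hΞ
  rw [mean_eq hm h hΞ a (posX_ae_eq hm h hΞ),
    two_pi_mul_integral (admissible_amplitude hm h hΞ).1 a.1 (integral_inner_smul_amplitude hm h),
    l2Inner, ← integral_const_mul]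
  congr 1; funext k
  simp only [RCLike.inner_apply]
  ring

theorem l2Norm_sq_posX (hm : 0 < m) (h : η ^ 2 - τ ^ 2 = 4) (hΞ : MemLp Ξ 2 volume) :
    (l2Norm (posX (eigenfunction m η τ Ξ)) : ℂ) ^ 2 = 1 / 2 * (l2Norm
      (fun k => ((1 / √(k ^ 2 + 4 * m ^ 2 / η ^ 2) : ℝ) : ℂ) * Ξ k) : ℂ) ^ 2 := by
  have a := admissible_fst_smul_amplitude hm h hΞ
  rw [l2Norm_sq_eq a (posX_ae_eq hm h hΞ),
    two_pi_mul_integral a.1 a.1 (integral_inner_self_smul_amplitude hm h),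
    l2Norm_sq (memLp_inv_sqrt_mul hm (ne_zero_of_sq_sub_sq h) hΞ), l2Inner, ← integral_const_mul]
  simp only [inner_mul_real, mul_left_comm (1 / 2 : ℂ)]

theorem mean_posY (hm : 0 < m) (h : η ^ 2 - τ ^ 2 = 4) (hΞ : MemLp Ξ 2 volume) {Ξ' : ℝ → ℂ}
    (hw : HasWeakDeriv Ξ Ξ') (hΞ' : MemLp Ξ' 2 volume) :
    mean posY (eigenfunction m η τ Ξ) = l2Inner Ξ (fun k => I * Ξ' k) := by
  rw [mean_eq hm h hΞ (admissible_deriv hm h hΞ hΞ') (posY_ae_eq hm h hΞ hw hΞ'),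
    two_pi_mul_integral_inner_deriv hm h hΞ hΞ hΞ', l2Inner, ← integral_const_mul]
  congr 1; funext k
  simp only [RCLike.inner_apply]
  ring

theorem l2Norm_sq_posY (hm : 0 < m) (h : η ^ 2 - τ ^ 2 = 4) (hΞ : MemLp Ξ 2 volume) {Ξ' : ℝ → ℂ}
    (hw : HasWeakDeriv Ξ Ξ') (hΞ' : MemLp Ξ' 2 volume) :
    (l2Norm (posY (eigenfunction m η τ Ξ)) : ℂ) ^ 2 = (l2Norm (fun k => I * Ξ' k) : ℂ) ^ 2
      + 1 / 4 * (l2Norm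
        (fun k => ((1 / √(k ^ 2 + 4 * m ^ 2 / η ^ 2) : ℝ) : ℂ) * Ξ k) : ℂ) ^ 2 := by
  rw [l2Norm_sq_eq (admissible_deriv hm h hΞ hΞ') (posY_ae_eq hm h hΞ hw hΞ'),
    two_pi_mul_integral_inner_deriv_self hm h hΞ hΞ', ← l2Norm_sq hΞ']
  have e : l2Norm (fun k => I * Ξ' k) = l2Norm Ξ' := by
    rw [l2Norm, l2Norm, eLpNorm_congr_norm_ae (g := Ξ')
      (Filter.Eventually.of_forall fun k => by simp)]
  rw [e]

end Observables

end DiracLine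

end

theorem corollary1p4 (m η τ : ℝ) (hm : 0 < m) (hητ : η ^ 2 - τ ^ 2 = 4)
    (Ξ : ℝ → ℂ) (hΞ : MemLp Ξ 2 volume) :
    DiracLine.InDomain DiracLine.posX (DiracLine.eigenfunction m η τ Ξ) ∧
    (DiracLine.InDomain DiracLine.posY (DiracLine.eigenfunction m η τ Ξ) ↔
      ∃ Ξ' : ℝ → ℂ, DiracLine.HasWeakDeriv Ξ Ξ' ∧ MemLp Ξ' 2 volume) ∧
    (DiracLine.l2Norm Ξ = 1 →
      -- spin
      (DiracLine.mean DiracLine.spin (DiracLine.eigenfunction m η τ Ξ) = -((τ : ℂ) / η) ∧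
        DiracLine.variance DiracLine.spin (DiracLine.eigenfunction m η τ Ξ)
          = 4 / (η : ℂ) ^ 2) ∧
      -- position, transversal to the line
      (DiracLine.mean DiracLine.posX (DiracLine.eigenfunction m η τ Ξ)
          = (τ : ℂ) / (2 * η) *
            DiracLine.l2Inner Ξ
              (fun k => ((k / (k ^ 2 + 4 * m ^ 2 / η ^ 2) : ℝ) : ℂ) * Ξ k) ∧
        DiracLine.variance DiracLine.posX (DiracLine.eigenfunction m η τ Ξ)
          = 1 / 2 * (DiracLine.l2Norm
              (fun k => ((1 / √(k ^ 2 + 4 * m ^ 2 / η ^ 2) : ℝ) : ℂ) * Ξ k) : ℂ) ^ 2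
            - (τ : ℂ) ^ 2 / (4 * (η : ℂ) ^ 2) *
              (DiracLine.l2Inner Ξ
                (fun k => ((k / (k ^ 2 + 4 * m ^ 2 / η ^ 2) : ℝ) : ℂ) * Ξ k)) ^ 2) ∧
      -- position, along the line
      (∀ Ξ' : ℝ → ℂ, DiracLine.HasWeakDeriv Ξ Ξ' → MemLp Ξ' 2 volume →
        DiracLine.mean DiracLine.posY (DiracLine.eigenfunction m η τ Ξ)
            = DiracLine.l2Inner Ξ (fun k => I * Ξ' k) ∧
          DiracLine.variance DiracLine.posY (DiracLine.eigenfunction m η τ Ξ)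
            = (DiracLine.l2Norm (fun k => I * Ξ' k) : ℂ) ^ 2
              + 1 / 4 * (DiracLine.l2Norm
                (fun k => ((1 / √(k ^ 2 + 4 * m ^ 2 / η ^ 2) : ℝ) : ℂ) * Ξ k) : ℂ) ^ 2
              - (DiracLine.l2Inner Ξ (fun k => I * Ξ' k)) ^ 2) ∧
      -- velocity
      (DiracLine.mean DiracLine.velX (DiracLine.eigenfunction m η τ Ξ) = 0 ∧
        DiracLine.mean DiracLine.velY (DiracLine.eigenfunction m η τ Ξ) = 0 ∧
        DiracLine.variance DiracLine.velX (DiracLine.eigenfunction m η τ Ξ) = 1 ∧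
        DiracLine.variance DiracLine.velY (DiracLine.eigenfunction m η τ Ξ) = 1)) := by
  open DiracLine in
  have hηc : (η : ℂ) ≠ 0 := by exact_mod_cast ne_zero_of_sq_sub_sq hητ
  have hc : (η : ℂ) ^ 2 - (τ : ℂ) ^ 2 = 4 := by exact_mod_cast hητ
  refine ⟨inDomain_posX hm hητ hΞ, ⟨fun h => exists_weakDeriv_of_posY hm hητ hΞ h.2,
    fun ⟨Ξ', hw, hΞ'⟩ => ⟨memLp_eigenfunction hm hητ hΞ, memLp_posY hm hητ hΞ hw hΞ'⟩⟩,
    fun hn => ⟨⟨mean_spin hm hητ hΞ hn, ?_⟩, ⟨mean_posX hm hητ hΞ, ?_⟩,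
      fun Ξ' hw hΞ' => ⟨mean_posY hm hητ hΞ hw hΞ', ?_⟩,
      mean_velX hm hητ hΞ hn, mean_velY hm hητ hΞ hn, ?_, ?_⟩⟩
  · rw [variance, mean_spin hm hητ hΞ hn]
    have e : (l2Norm (spin (eigenfunction m η τ Ξ)) : ℂ) ^ 2 = 1 :=
      l2Norm_act hm hητ hΞ hn norm_act_σ₃
    rw [e]
    field_simp
    linear_combination hc
  · rw [variance, l2Norm_sq_posX hm hητ hΞ, mean_posX hm hητ hΞ]
    ring
  · rw [variance, l2Norm_sq_posY hm hητ hΞ hw hΞ', mean_posY hm hητ hΞ hw hΞ']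
  · rw [variance, mean_velX hm hητ hΞ hn]
    have e : (l2Norm (velX (eigenfunction m η τ Ξ)) : ℂ) ^ 2 = 1 :=
      l2Norm_act hm hητ hΞ hn norm_act_σ₁
    rw [e]; ring
  · rw [variance, mean_velY hm hητ hΞ hn]
    have e : (l2Norm (velY (eigenfunction m η τ Ξ)) : ℂ) ^ 2 = 1 :=
      l2Norm_act hm hητ hΞ hn norm_act_σ₂
    rw [e]; ring
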